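/- Let $\mathcal{L}$ be a nonempty compact surface lamination: a nonempty compact metrizable space with an atlas of homeomorphisms $\varphi_i:E_i\to D_i\times T_i$ from open sets covering $\mathcal{L}$, where $D_i\subset\mathbb{R}^2$ is an open disk and $T_i$ a topological space, whose coordinate changes have the form $(z,t)\mapsto(\zeta(z,t),\tau(t))$, with $\zeta$ smooth in $z$ and all its $z$-derivatives continuous in $(z,t)$. Let $\mathcal{L}$ carry a $C^\infty$ Riemannian metric, i.e. a Riemannian metric on each leaf whose coefficients in the charts are smooth in $z$ with all $z$-derivatives continuous in $(z,t)$ (for instance, a metric of negative curvature when the leaves are hyperbolic). Let $T^1\mathcal{L}=\{(x,v): x\in\mathcal{L},\ v\in T_xL_x,\ \|v\|=1\}$ be the unit tangent bundle, where $L_x$ is the leaf through $x$, and let $g_t$ $(t\in\mathbb{R})$ be the laminated geodesic flow on $T^1\mathcal{L}$, which on the unit tangent bundle of each leaf is the geodesic flow of that leaf. Then $g_t$ admits no synchronized global transverse section: there is no closed set $K\subset T^1\mathcal{L}$ for which there is a number $t_0>0$ such that for every $v\in T^1\mathcal{L}$ one has $\{t\in\mathbb{R}: g_t(v)\in K\}=s+t_0\mathbb{Z}$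 for some $s\in\mathbb{R}$ (depending on $v$). -/

import Mathlib

open Set Filter Topology
open scoped ContDiff

noncomputable section

/-- The model plane in which the plaques are charted. -/
abbrev Plane : Type := EuclideanSpace ℝ (Fin 2)

/-- A function `f` of `(z, t)`, with `z` in the plane and `t` in a transversal, is *leafwise smooth*
on the (open) set `U` if it is `C^∞` in `z` for every fixed `t` and all its iterated derivatives with
respect to `z`, including the zeroth, are jointly continuous in `(z, t)`. -/
def LeafwiseSmoothOn {T : Type*} [TopologicalSpace T] {F : Type*} [NormedAddCommGroup F]
    [NormedSpace ℝ F] (f : Plane × T → F) (U : Set (Plane × T)) : Prop :=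
  (∀ t : T, ContDiffOn ℝ ∞ (fun z => f (z, t)) {z | (z, t) ∈ U}) ∧
  ∀ n : ℕ, ContinuousOn
    (fun p : Plane × T => iteratedFDeriv ℝ n (fun z => f (z, p.2)) p.1) U

/-- The structure of a surface lamination on a topological space `X`: an atlas of foliated charts
`φ_i : E_i → D_i × T_i`, with `D_i` an open disk in the plane and `T_i` a topological space, whose
coordinate changes have the form `(z, t) ↦ (ζ (z, t), τ t)` with `ζ` leafwise smooth. -/
structure SurfaceLamination (X : Type*) [TopologicalSpace X] where
  /-- the index set of the atlas -/
  ι : Type*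
  /-- the transversals -/
  T : ι → Type*
  /-- the topology of the transversals -/
  topT : ∀ i, TopologicalSpace (T i)
  /-- the foliated charts -/
  chart : ∀ i, OpenPartialHomeomorph X (Plane × T i)
  /-- the image of every foliated chart is the product of an open disk and the transversal -/
  target_eq : ∀ i, ∃ (c : Plane) (r : ℝ), 0 < r ∧ (chart i).target = Metric.ball c r ×ˢ univ
  /-- the foliated charts cover the space -/
  cover : ∀ x : X, ∃ i, x ∈ (chart i).source
  /-- the second component of a coordinate change is a function of `t` only -/
  transverse : ∀ i j, ∀ x ∈ (chart i).source ∩ (chart j).source,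
    ∀ y ∈ (chart i).source ∩ (chart j).source,
      (chart i x).2 = (chart i y).2 → (chart j x).2 = (chart j y).2
  /-- the first component of a coordinate change is leafwise smooth -/
  smooth : ∀ i j, LeafwiseSmoothOn (fun p => (chart j ((chart i).symm p)).1)
    ((chart i).symm.trans (chart j)).source

attribute [instance] SurfaceLamination.topT

namespace SurfaceLamination

variable {X : Type*} [TopologicalSpace X] (L : SurfaceLamination X)

/-- The leafwise derivative, at the point `x`, of the coordinate change from the chart `i` to the
chart `j`. -/
def coordChange (i j : L.ι) (x : X) : Plane →L[ℝ] Plane :=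
  fderiv ℝ (fun z => (L.chart j ((L.chart i).symm (z, (L.chart i x).2))).1) (L.chart i x).1

lemma chart_mem_overlap {i j : L.ι} {x : X} (hi : x ∈ (L.chart i).source)
    (hj : x ∈ (L.chart j).source) :
    L.chart i x ∈ ((L.chart i).symm.trans (L.chart j)).source := by
  simp [(L.chart i).map_source hi, (L.chart i).left_inv hi, hj]

lemma eventually_overlap {i j : L.ι} {x : X} (hi : x ∈ (L.chart i).source)
    (hj : x ∈ (L.chart j).source) :
    ∀ᶠ z in 𝓝 (L.chart i x).1,
      (z, (L.chart i x).2) ∈ ((L.chart i).symm.trans (L.chart j)).source := by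
  have hc : ContinuousAt (fun z : Plane => (z, (L.chart i x).2)) (L.chart i x).1 := by fun_prop
  exact hc.eventually
    (((L.chart i).symm.trans (L.chart j)).open_source.mem_nhds (L.chart_mem_overlap hi hj))

lemma differentiableAt_overlap {i j : L.ι} {x : X} (hi : x ∈ (L.chart i).source)
    (hj : x ∈ (L.chart j).source) :
    DifferentiableAt ℝ (fun z => (L.chart j ((L.chart i).symm (z, (L.chart i x).2))).1)
      (L.chart i x).1 :=
  (((L.smooth i j).1 (L.chart i x).2).contDiffAt (L.eventually_overlap hi hj)).differentiableAt
    (by simp)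

/-- The tangent bundle of the lamination as a vector bundle core: the bundle of rank two over `X`,
trivial over the domain of every foliated chart, whose transition maps are the leafwise derivatives
of the coordinate changes. A tangent vector at `x` is thus given by its coordinates in any
foliated chart around `x`, transforming by these derivatives. -/
def tangentCore : VectorBundleCore ℝ X Plane L.ι where
  baseSet i := (L.chart i).source
  isOpen_baseSet i := (L.chart i).open_source
  indexAt x := (L.cover x).choose
  mem_baseSet_at x := (L.cover x).choose_spec
  coordChange := L.coordChange
  coordChange_self := by
    intro i x hx v
    have h : (fun z => (L.chart i ((L.chart i).symm (z, (L.chart i x).2))).1)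
        =ᶠ[𝓝 (L.chart i x).1] fun z => z := by
      filter_upwards [L.eventually_overlap hx hx] with z hz
      rw [(L.chart i).right_inv (by simpa using hz.1)]
    have h' := h.fderiv_eq (𝕜 := ℝ)
    rw [coordChange, h']
    simp
  continuousOn_coordChange := by
    intro i j
    have h1 := (L.smooth i j).2 1
    have h2 : ContinuousOn (fun p : Plane × L.T i =>
        fderiv ℝ (fun z => (L.chart j ((L.chart i).symm (z, p.2))).1) p.1)
        ((L.chart i).symm.trans (L.chart j)).source := by
      have h3 := (continuousMultilinearCurryFin1 ℝ Plane Plane).continuous.comp_continuousOn h1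
      refine h3.congr fun p _ => ?_
      ext v k
      simp [iteratedFDeriv_one_apply]
    exact h2.comp ((L.chart i).continuousOn.mono inter_subset_left)
      fun x hx => L.chart_mem_overlap hx.1 hx.2
  coordChange_comp := by
    rintro i j k x ⟨⟨hi, hj⟩, hk⟩ v
    have h0 : (L.chart i).symm ((L.chart i x).1, (L.chart i x).2) = x := (L.chart i).left_inv hi
    have e : (fun z => (L.chart k ((L.chart i).symm (z, (L.chart i x).2))).1)
        =ᶠ[𝓝 (L.chart i x).1]
        (fun z => (L.chart k ((L.chart j).symm (z, (L.chart j x).2))).1) ∘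
          fun z => (L.chart j ((L.chart i).symm (z, (L.chart i x).2))).1 := by
      filter_upwards [L.eventually_overlap hi hj] with z hz
      have hz1 : (z, (L.chart i x).2) ∈ (L.chart i).target := by simpa using hz.1
      have hz2 : (L.chart i).symm (z, (L.chart i x).2) ∈ (L.chart j).source := by simpa using hz.2
      have ht : (L.chart j ((L.chart i).symm (z, (L.chart i x).2))).2 = (L.chart j x).2 := by
        refine L.transverse i j _ ⟨(L.chart i).map_target hz1, hz2⟩ x ⟨hi, hj⟩ ?_
        rw [(L.chart i).right_inv hz1]
      simp only [Function.comp_apply]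
      rw [← ht, Prod.mk.eta, (L.chart j).left_inv hz2]
    have hd := L.differentiableAt_overlap hi hj
    have hd' := L.differentiableAt_overlap hj hk
    have hx : (L.chart j ((L.chart i).symm ((L.chart i x).1, (L.chart i x).2))).1
        = (L.chart j x).1 := by rw [h0]
    rw [← hx] at hd'
    change DifferentiableAt ℝ _ ((fun z => (L.chart j ((L.chart i).symm (z, (L.chart i x).2))).1)
      (L.chart i x).1) at hd'
    simp only [coordChange]
    have hc := (hd'.hasFDerivAt.comp (L.chart i x).1 hd.hasFDerivAt).congr_of_eventuallyEq e
    rw [hc.fderiv]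
    beta_reduce
    rw [hx]
    rfl

/-- The tangent plane `T_x L_x` at `x` to the leaf through `x`. -/
abbrev TangentPlane (x : X) : Type := L.tangentCore.Fiber x

/-- The tangent bundle of the lamination, with its topology as a vector bundle over `X`. -/
abbrev TangentBundle : Type _ := Bundle.TotalSpace Plane L.TangentPlane

/-- The coordinates, in the foliated chart `i`, of a tangent vector `p` at a point of its domain. -/
def vectorCoord (i : L.ι) (p : L.TangentBundle) : Plane :=
  L.tangentCore.coordChange (L.tangentCore.indexAt p.proj) i p.proj p.2

/-- The tangent vector at `x` with coordinates `v` in the foliated chart `i` around `x`. -/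
def vectorOfCoord (i : L.ι) (x : X) (v : Plane) : L.TangentPlane x :=
  L.tangentCore.coordChange i (L.tangentCore.indexAt x) x v

/-- A `C^∞` Riemannian metric on a lamination: an inner product on every tangent plane such that in
every foliated chart the coefficients of the metric are smooth along the plaques, with all
derivatives continuous in the transverse direction too. -/
structure SmoothMetric extends Bundle.RiemannianMetric L.TangentPlane where
  /-- leafwise smoothness of the coefficients of the metric -/
  smooth_coeff : ∀ (i : L.ι) (v w : Plane), LeafwiseSmoothOn
    (fun p => inner ((L.chart i).symm p) (L.vectorOfCoord i ((L.chart i).symm p) v)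
      (L.vectorOfCoord i ((L.chart i).symm p) w)) (L.chart i).target

namespace SmoothMetric

variable {L} (m : L.SmoothMetric)

/-- The metric in the foliated chart `i`: the inner product of the vectors with coordinates `v` and
`w` at the point with coordinates `(z, t)`. -/
def coeff (i : L.ι) (v w : Plane) (p : Plane × L.T i) : ℝ :=
  m.inner ((L.chart i).symm p) (L.vectorOfCoord i ((L.chart i).symm p) v)
    (L.vectorOfCoord i ((L.chart i).symm p) w)

/-- The derivative of the coefficient `coeff i v w` along the plaque in the direction `u`. -/
def coeffDeriv (i : L.ι) (u v w : Plane) (p : Plane × L.T i) : ℝ :=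
  fderiv ℝ (fun z => m.coeff i v w (z, p.2)) p.1 u

/-- The Christoffel symbol of the first kind
`Γ(u, v; w) = (∂_u ⟨v, w⟩ + ∂_v ⟨u, w⟩ - ∂_w ⟨u, v⟩) / 2` of the leaf metric in the chart `i`. -/
def christoffel (i : L.ι) (u v w : Plane) (p : Plane × L.T i) : ℝ :=
  (m.coeffDeriv i u v w p + m.coeffDeriv i v u w p - m.coeffDeriv i w u v p) / 2

/-- The unit tangent bundle `T¹L` of the lamination, with the topology induced by that of the
tangent bundle. -/
def UnitTangentBundle : Type _ :=
  {p : L.TangentBundle // m.inner p.proj p.2 p.2 = 1}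

instance : TopologicalSpace m.UnitTangentBundle :=
  inferInstanceAs (TopologicalSpace {p : L.TangentBundle // m.inner p.proj p.2 p.2 = 1})

/-- The curve `c` in the unit tangent bundle is the velocity curve of a geodesic, defined for all
times, of a leaf: in every foliated chart the base point stays locally in one plaque, the
derivative of its coordinates `z` is the vector `c`, and `z` solves the geodesic equation
`z'' + Γ(z', z') = 0`, which is paired here with all vectors `w` by means of the metric. -/
def IsGeodesic (c : ℝ → m.UnitTangentBundle) : Prop :=
  ∀ (s₀ : ℝ) (i : L.ι), (c s₀).1.proj ∈ (L.chart i).source →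
    ∀ᶠ s in 𝓝 s₀,
      (c s).1.proj ∈ (L.chart i).source ∧
      (L.chart i (c s).1.proj).2 = (L.chart i (c s₀).1.proj).2 ∧
      HasDerivAt (fun r => (L.chart i (c r).1.proj).1) (L.vectorCoord i (c s).1) s ∧
      ∃ a : Plane, HasDerivAt (fun r => L.vectorCoord i (c r).1) a s ∧
        ∀ w : Plane, m.coeff i a w (L.chart i (c s).1.proj) +
          m.christoffel i (L.vectorCoord i (c s).1) (L.vectorCoord i (c s).1) w
            (L.chart i (c s).1.proj) = 0

open Classical in
/-- The laminated geodesic flow `g_t` on the unit tangent bundle: `g_t v` is the velocity at time `t`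
of the geodesic with initial velocity `v`, in the leaf through the base point of `v`. This geodesic
is unique, and it is defined for all times if the lamination is compact; the other branch, a
default value, is only there because Lean functions are total. -/
def geodesicFlow (t : ℝ) (v : m.UnitTangentBundle) : m.UnitTangentBundle :=
  if h : ∃ c : ℝ → m.UnitTangentBundle, m.IsGeodesic c ∧ c 0 = v then h.choose t else v

end SmoothMetric

end SurfaceLamination

/-- A *synchronized global transverse section* of a flow `g` is a closed set which every orbit
meets exactly at intervals of one fixed length `t₀ > 0`: the times at which the orbit of a point
`v` is in `K` are the numbers `s + n t₀`, with `n` an integer and `s` a real number depending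
on `v`. -/
def IsSynchronizedGlobalTransverseSection {Y : Type*} [TopologicalSpace Y] (g : ℝ → Y → Y)
    (K : Set Y) : Prop :=
  IsClosed K ∧ ∃ t₀ : ℝ, 0 < t₀ ∧ ∀ v : Y, ∃ s : ℝ,
    {t : ℝ | g t v ∈ K} = range fun n : ℤ => s + n * t₀

end

noncomputable section

/-! ### Tangent vectors in foliated charts and the topology of the unit tangent bundle. -/

namespace SurfaceLamination

variable {X : Type*} [TopologicalSpace X] (L : SurfaceLamination X)

/-! A synchronized section `K` would give a phase `σ : T¹L → ℝ / t₀ℤ`, the time modulo `t₀` at which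
an orbit meets `K`, with `σ (g_t v) = σ v - t`. Since `K` is closed and the circle is compact, `σ`
is continuous (`exists_continuous_phase`).

The contradiction comes from the flip `v ↦ -v`. It reverses the flow, `g_t (-v) = -g_{-t} v`
(`geodesicFlow_opp`), and within each circle fibre it is joined to the identity by a half turn.
Following `σ` along a half turn from `v` to `-v` lifts `σ (-v) - σ v` to a real number. There are
two half turns, and no global way to choose between them without an orientation, so the two lifts
are added. The sum is a continuous function `h : T¹L → ℝ` with `h v = 2 (σ (-v) - σ v)` modulo `t₀`
(`exists_continuous_lift_opp`). Along an orbit, `σ (-v)` grows at unit speed while `σ v` decreases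
at unit speed. Hence `h (g_t v) - h v - 4 t` lies in `t₀ℤ`; it is continuous in `t` and zero at `t =
0`, so `h (g_t v) = h v + 4 t`. This is impossible because `h` is bounded on the compact space
`T¹L`.

Most of the work is the analytic foundation: `T¹L` is compact Hausdorff, geodesics exist for all
times and are unique (`exists_isGeodesic`, `eq_of_isGeodesicAt`), and the flow is jointly continuous
(`continuous_geodesicFlow`). Within one chart the geodesic equation is an ODE depending on the
transverse parameter, and the Grönwall inequality gives dependence across plaques
(`exists_nhds_geodesic_dependence`). Compactness makes local times uniform. -/

lemma vectorOfCoord_vectorCoord {i : L.ι} {p : L.TangentBundle}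
    (hp : p.proj ∈ (L.chart i).source) :
    L.vectorOfCoord i p.proj (L.vectorCoord i p) = p.2 := by
  have h := L.tangentCore.coordChange_comp (L.tangentCore.indexAt p.proj) i
    (L.tangentCore.indexAt p.proj) p.proj
    ⟨⟨L.tangentCore.mem_baseSet_at _, hp⟩, L.tangentCore.mem_baseSet_at _⟩ p.2
  exact h.trans (L.tangentCore.coordChange_self _ _ (L.tangentCore.mem_baseSet_at _) p.2)

lemma vectorCoord_vectorOfCoord {i : L.ι} {x : X} (hx : x ∈ (L.chart i).source) (u : Plane) :
    L.vectorCoord i ⟨x, L.vectorOfCoord i x u⟩ = u := by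
  have h := L.tangentCore.coordChange_comp i (L.tangentCore.indexAt x) i x
    ⟨⟨hx, L.tangentCore.mem_baseSet_at _⟩, hx⟩ u
  rw [L.tangentCore.coordChange_self _ _ hx] at h
  exact h

lemma vectorCoord_eq_coordChange {i j : L.ι} {p : L.TangentBundle}
    (hi : p.proj ∈ (L.chart i).source) (hj : p.proj ∈ (L.chart j).source) :
    L.vectorCoord j p = L.coordChange i j p.proj (L.vectorCoord i p) :=
  (L.tangentCore.coordChange_comp (L.tangentCore.indexAt p.proj) i j p.proj
    ⟨⟨L.tangentCore.mem_baseSet_at _, hi⟩, hj⟩ p.2).symm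

lemma vectorOfCoord_coordChange {i j : L.ι} {x : X}
    (hi : x ∈ (L.chart i).source) (hj : x ∈ (L.chart j).source) (u : Plane) :
    L.vectorOfCoord j x (L.coordChange i j x u) = L.vectorOfCoord i x u :=
  L.tangentCore.coordChange_comp i j (L.tangentCore.indexAt x) x
    ⟨⟨hi, hj⟩, L.tangentCore.mem_baseSet_at _⟩ u

lemma vectorOfCoord_add (i : L.ι) (x : X) (u v : Plane) :
    L.vectorOfCoord i x (u + v) = L.vectorOfCoord i x u + L.vectorOfCoord i x v :=
  map_add (L.tangentCore.coordChange i (L.tangentCore.indexAt x) x) u v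

lemma vectorOfCoord_smul (i : L.ι) (x : X) (r : ℝ) (u : Plane) :
    L.vectorOfCoord i x (r • u) = r • L.vectorOfCoord i x u :=
  map_smul (L.tangentCore.coordChange i (L.tangentCore.indexAt x) x) r u

lemma vectorCoord_add (i : L.ι) (x : X) (u v : L.TangentPlane x) :
    L.vectorCoord i ⟨x, u + v⟩ = L.vectorCoord i ⟨x, u⟩ + L.vectorCoord i ⟨x, v⟩ :=
  map_add (L.tangentCore.coordChange (L.tangentCore.indexAt x) i x) u v

lemma vectorCoord_smul (i : L.ι) (x : X) (r : ℝ) (u : L.TangentPlane x) :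
    L.vectorCoord i ⟨x, r • u⟩ = r • L.vectorCoord i ⟨x, u⟩ :=
  map_smul (L.tangentCore.coordChange (L.tangentCore.indexAt x) i x) r u

lemma vectorCoord_neg (i : L.ι) (x : X) (u : L.TangentPlane x) :
    L.vectorCoord i ⟨x, -u⟩ = -L.vectorCoord i ⟨x, u⟩ :=
  map_neg (L.tangentCore.coordChange (L.tangentCore.indexAt x) i x) u

/-- The local trivialization followed by the foliated chart on the base is a homeomorphism onto its
image. Both contribute the same condition on the base point, which is why one principal filter
remains. -/
lemma nhds_tangentBundle {i : L.ι} {p : L.TangentBundle} (hp : p.proj ∈ (L.chart i).source) :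
    𝓝 p = comap (fun q : L.TangentBundle => (L.chart i q.proj, L.vectorCoord i q))
      (𝓝 (L.chart i p.proj, L.vectorCoord i p)) ⊓ 𝓟 {q | q.proj ∈ (L.chart i).source} := by
  have h1 := (L.tangentCore.localTriv i).toOpenPartialHomeomorph.nhds_eq_comap_inf_principal
    (x := p) (by exact hp)
  have h2 := (L.chart i).nhds_eq_comap_inf_principal hp
  rw [h1]
  change comap (fun q : L.TangentBundle => (q.proj, L.vectorCoord i q))
    (𝓝 (p.proj, L.vectorCoord i p)) ⊓ 𝓟 {q | q.proj ∈ (L.chart i).source} = _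
  rw [nhds_prod_eq, nhds_prod_eq, h2, Filter.prod_eq_inf, Filter.prod_eq_inf, comap_inf, comap_inf,
    comap_inf, comap_inf]
  simp only [comap_comap, comap_principal]
  change comap (fun q : L.TangentBundle => L.chart i q.proj) (𝓝 (L.chart i p.proj)) ⊓
    𝓟 {q : L.TangentBundle | q.proj ∈ (L.chart i).source} ⊓
    comap (fun q : L.TangentBundle => L.vectorCoord i q) (𝓝 (L.vectorCoord i p)) ⊓
    𝓟 {q : L.TangentBundle | q.proj ∈ (L.chart i).source} =
    comap (fun q : L.TangentBundle => L.chart i q.proj) (𝓝 (L.chart i p.proj)) ⊓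
    comap (fun q : L.TangentBundle => L.vectorCoord i q) (𝓝 (L.vectorCoord i p)) ⊓
    𝓟 {q : L.TangentBundle | q.proj ∈ (L.chart i).source}
  rw [inf_right_comm (comap _ _) (𝓟 _) (comap _ _), inf_assoc _ (𝓟 _) (𝓟 _), inf_idem]

namespace SmoothMetric

variable {L} (m : L.SmoothMetric)

lemma continuous_proj : Continuous fun y : m.UnitTangentBundle => y.1.proj :=
  L.tangentCore.continuous_proj.comp continuous_subtype_val

/-- Convergence is tested in a single chart around the limit; the continuity arguments on `T¹L`
below go through this criterion. -/
lemma tendsto_iff_of_mem {α : Type*} {l : Filter α} {f : α → m.UnitTangentBundle} {i : L.ι}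
    {y : m.UnitTangentBundle} (hy : y.1.proj ∈ (L.chart i).source) :
    Tendsto f l (𝓝 y) ↔ (∀ᶠ a in l, (f a).1.proj ∈ (L.chart i).source) ∧
      Tendsto (fun a => L.chart i (f a).1.proj) l (𝓝 (L.chart i y.1.proj)) ∧
      Tendsto (fun a => L.vectorCoord i (f a).1) l (𝓝 (L.vectorCoord i y.1)) := by
  have h : 𝓝 y = comap (fun q : m.UnitTangentBundle => q.1) (𝓝 y.1) := nhds_subtype_eq_comap
  rw [h, tendsto_comap_iff, L.nhds_tangentBundle hy, tendsto_inf, tendsto_comap_iff,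
    tendsto_principal, nhds_prod_eq, tendsto_prod_iff']
  exact and_comm

lemma continuousAt_coord {i : L.ι} {y : m.UnitTangentBundle}
    (hy : y.1.proj ∈ (L.chart i).source) :
    ContinuousAt (fun y : m.UnitTangentBundle => L.chart i y.1.proj) y ∧
      ContinuousAt (fun y : m.UnitTangentBundle => L.vectorCoord i y.1) y :=
  ((m.tendsto_iff_of_mem hy).1 tendsto_id).2

/-- Distinct base points are separated in `X`; over one base point, the vectors are separated by
their coordinates in a common chart. -/
instance [T2Space X] : T2Space m.UnitTangentBundle := by
  refine t2Space_iff_disjoint_nhds.2 fun y y' hne => ?_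
  by_cases hp : y.1.proj = y'.1.proj
  · obtain ⟨i, hi⟩ := L.cover y.1.proj
    have hi' : y'.1.proj ∈ (L.chart i).source := hp ▸ hi
    have hv : L.vectorCoord i y.1 ≠ L.vectorCoord i y'.1 := by
      intro h
      refine hne (Subtype.ext ?_)
      obtain ⟨⟨x, v⟩, hx⟩ := y
      obtain ⟨⟨x', v'⟩, hx'⟩ := y'
      obtain rfl : x = x' := hp
      have e1 := L.vectorOfCoord_vectorCoord hi
      have e2 := L.vectorOfCoord_vectorCoord hi'
      dsimp only at e1 e2 h ⊢
      rw [← e1, ← e2, h]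
    exact (m.continuousAt_coord hi).2.disjoint (disjoint_nhds_nhds.2 hv)
      (m.continuousAt_coord hi').2
  · exact (m.continuous_proj.tendsto y).disjoint (disjoint_nhds_nhds.2 hp)
      (m.continuous_proj.tendsto y')

/-- The unit tangent vector with coordinates `u` at the point with coordinates `p` in the foliated
chart `i`. -/
def ofCoord (i : L.ι) (p : Plane × L.T i) (u : Plane) (h : m.coeff i u u p = 1) :
    m.UnitTangentBundle :=
  ⟨⟨(L.chart i).symm p, L.vectorOfCoord i _ u⟩, h⟩

lemma chart_ofCoord {i : L.ι} {p : Plane × L.T i} (hp : p ∈ (L.chart i).target) {u : Plane}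
    (h : m.coeff i u u p = 1) : L.chart i (m.ofCoord i p u h).1.proj = p :=
  (L.chart i).right_inv hp

lemma proj_ofCoord_mem {i : L.ι} {p : Plane × L.T i} (hp : p ∈ (L.chart i).target) {u : Plane}
    (h : m.coeff i u u p = 1) : (m.ofCoord i p u h).1.proj ∈ (L.chart i).source :=
  (L.chart i).map_target hp

lemma vectorCoord_ofCoord {i : L.ι} {p : Plane × L.T i} (hp : p ∈ (L.chart i).target) {u : Plane}
    (h : m.coeff i u u p = 1) : L.vectorCoord i (m.ofCoord i p u h).1 = u :=
  L.vectorCoord_vectorOfCoord ((L.chart i).map_target hp) u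

lemma ext_coord {i : L.ι} {y y' : m.UnitTangentBundle} (hy : y.1.proj ∈ (L.chart i).source)
    (hy' : y'.1.proj ∈ (L.chart i).source) (h : L.chart i y.1.proj = L.chart i y'.1.proj)
    (hv : L.vectorCoord i y.1 = L.vectorCoord i y'.1) : y = y' := by
  obtain ⟨⟨x, v⟩, hx⟩ := y
  obtain ⟨⟨x', v'⟩, hx'⟩ := y'
  obtain rfl : x = x' := (L.chart i).injOn hy hy' h
  have e1 := L.vectorOfCoord_vectorCoord hy
  have e2 := L.vectorOfCoord_vectorCoord hy'
  refine Subtype.ext ?_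
  dsimp only at e1 e2 hv ⊢
  rw [← e1, ← e2, hv]

lemma coeff_chart {i : L.ι} {x : X} (hx : x ∈ (L.chart i).source) (v w : Plane) :
    m.coeff i v w (L.chart i x) = m.inner x (L.vectorOfCoord i x v) (L.vectorOfCoord i x w) := by
  unfold coeff
  rw [(L.chart i).left_inv hx]

lemma coeff_vectorCoord {i : L.ι} {x : X} (hx : x ∈ (L.chart i).source) (a b : L.TangentPlane x) :
    m.coeff i (L.vectorCoord i ⟨x, a⟩) (L.vectorCoord i ⟨x, b⟩) (L.chart i x) = m.inner x a b := by
  rw [m.coeff_chart hx]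
  have e1 := L.vectorOfCoord_vectorCoord (i := i) (p := ⟨x, a⟩) hx
  have e2 := L.vectorOfCoord_vectorCoord (i := i) (p := ⟨x, b⟩) hx
  dsimp only at e1 e2
  rw [e1, e2]

lemma coeff_vectorCoord_self {i : L.ι} (y : m.UnitTangentBundle)
    (hy : y.1.proj ∈ (L.chart i).source) :
    m.coeff i (L.vectorCoord i y.1) (L.vectorCoord i y.1) (L.chart i y.1.proj) = 1 :=
  (m.coeff_vectorCoord hy y.1.2 y.1.2).trans y.2

lemma coeff_comm (i : L.ι) (v w : Plane) (p : Plane × L.T i) :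
    m.coeff i v w p = m.coeff i w v p :=
  m.symm _ _ _

lemma coeff_add_left (i : L.ι) (v v' w : Plane) (p : Plane × L.T i) :
    m.coeff i (v + v') w p = m.coeff i v w p + m.coeff i v' w p := by
  simp only [coeff, vectorOfCoord_add, map_add]
  rfl

lemma coeff_smul_left (i : L.ι) (r : ℝ) (v w : Plane) (p : Plane × L.T i) :
    m.coeff i (r • v) w p = r * m.coeff i v w p := by
  simp only [coeff, vectorOfCoord_smul, map_smul]
  rfl

lemma coeff_add_right (i : L.ι) (v w w' : Plane) (p : Plane × L.T i) :
    m.coeff i v (w + w') p = m.coeff i v w p + m.coeff i v w' p := by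
  simp only [m.coeff_comm i v, coeff_add_left]

lemma coeff_smul_right (i : L.ι) (r : ℝ) (v w : Plane) (p : Plane × L.T i) :
    m.coeff i v (r • w) p = r * m.coeff i v w p := by
  simp only [m.coeff_comm i v, coeff_smul_left]

lemma coeff_self_pos {i : L.ι} {p : Plane × L.T i} (hp : p ∈ (L.chart i).target) {u : Plane}
    (hu : u ≠ 0) : 0 < m.coeff i u u p := by
  refine m.pos _ _ fun h => hu ?_
  have h1 := L.vectorCoord_vectorOfCoord ((L.chart i).map_target hp) u
  rw [h] at h1
  rw [← h1]
  exact map_zero (L.tangentCore.coordChange _ i _)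

end SmoothMetric

end SurfaceLamination

/-! ### The geodesic equation of a chart as an ordinary differential equation. -/

/-- The standard basis vectors of the plane. -/
abbrev stdVec (k : Fin 2) : Plane := EuclideanSpace.single k (1 : ℝ)

lemma plane_eq_sum (v : Plane) : v = v 0 • stdVec 0 + v 1 • stdVec 1 := by
  ext k
  fin_cases k <;> simp [stdVec]

namespace SurfaceLamination.SmoothMetric

variable {X : Type*} [TopologicalSpace X] {L : SurfaceLamination X} (m : L.SmoothMetric)

/-- The metric is given as regular in the position for fixed vectors. Bilinearity reduces it to
three functions of the position, so regularity holds jointly in position and vectors. -/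
lemma coeff_expand (i : L.ι) (v w : Plane) (p : Plane × L.T i) :
    m.coeff i v w p = v 0 * w 0 * m.coeff i (stdVec 0) (stdVec 0) p +
      (v 0 * w 1 + v 1 * w 0) * m.coeff i (stdVec 0) (stdVec 1) p +
      v 1 * w 1 * m.coeff i (stdVec 1) (stdVec 1) p := by
  conv_lhs => rw [plane_eq_sum v, plane_eq_sum w]
  simp only [coeff_add_left, coeff_add_right, coeff_smul_left, coeff_smul_right]
  rw [m.coeff_comm i (stdVec 1) (stdVec 0)]
  ring

lemma continuousOn_coeff (i : L.ι) (v w : Plane) :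
    ContinuousOn (m.coeff i v w) (L.chart i).target := by
  have h := (m.smooth_coeff i v w).2 0
  refine ((continuousMultilinearCurryFin0 ℝ Plane ℝ).continuous.comp_continuousOn h).congr ?_
  intro p _
  rfl

lemma continuousAt_coeff {α : Type*} [TopologicalSpace α] {i : L.ι} {f g : α → Plane}
    {q : α → Plane × L.T i} {a : α} (hq : ContinuousAt q a) (hf : ContinuousAt f a)
    (hg : ContinuousAt g a) (ha : q a ∈ (L.chart i).target) :
    ContinuousAt (fun a => m.coeff i (f a) (g a) (q a)) a := by
  have key : ∀ v w, ContinuousAt (fun a => m.coeff i v w (q a)) a := fun v w =>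
    ContinuousAt.comp (f := q)
      ((m.continuousOn_coeff i v w).continuousAt ((L.chart i).open_target.mem_nhds ha)) hq
  have k := key (stdVec 0) (stdVec 0)
  have k' := key (stdVec 0) (stdVec 1)
  have k'' := key (stdVec 1) (stdVec 1)
  simp only [fun a => m.coeff_expand i (f a) (g a) (q a)]
  fun_prop

lemma contDiffOn_coeff (i : L.ι) (v w : Plane) (t : L.T i) :
    ContDiffOn ℝ ∞ (fun z => m.coeff i v w (z, t)) {z | (z, t) ∈ (L.chart i).target} :=
  (m.smooth_coeff i v w).1 t

end SurfaceLamination.SmoothMetric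

namespace SurfaceLamination.SmoothMetric

variable {X : Type*} [TopologicalSpace X] {L : SurfaceLamination X} (m : L.SmoothMetric)

lemma isOpen_slice (i : L.ι) (t : L.T i) : IsOpen {z : Plane | (z, t) ∈ (L.chart i).target} :=
  (L.chart i).open_target.preimage (Continuous.prodMk_left t)

lemma differentiableAt_coeff {i : L.ι} {p : Plane × L.T i} (hp : p ∈ (L.chart i).target)
    (v w : Plane) : DifferentiableAt ℝ (fun z => m.coeff i v w (z, p.2)) p.1 :=
  ((m.contDiffOn_coeff i v w p.2).contDiffAt ((isOpen_slice i p.2).mem_nhds hp)).differentiableAt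
    (by simp)

lemma coeffDeriv_expand {i : L.ι} {p : Plane × L.T i} (hp : p ∈ (L.chart i).target)
    (u v w : Plane) :
    m.coeffDeriv i u v w p = v 0 * w 0 * m.coeffDeriv i u (stdVec 0) (stdVec 0) p +
      (v 0 * w 1 + v 1 * w 0) * m.coeffDeriv i u (stdVec 0) (stdVec 1) p +
      v 1 * w 1 * m.coeffDeriv i u (stdVec 1) (stdVec 1) p := by
  have h := (((m.differentiableAt_coeff hp (stdVec 0) (stdVec 0)).hasFDerivAt.const_mul
      (v 0 * w 0)).add ((m.differentiableAt_coeff hp (stdVec 0) (stdVec 1)).hasFDerivAt.const_mul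
      (v 0 * w 1 + v 1 * w 0))).add
      ((m.differentiableAt_coeff hp (stdVec 1) (stdVec 1)).hasFDerivAt.const_mul (v 1 * w 1))
  unfold coeffDeriv
  have e : (fun z => m.coeff i v w (z, p.2)) = fun z =>
      v 0 * w 0 * m.coeff i (stdVec 0) (stdVec 0) (z, p.2) +
      (v 0 * w 1 + v 1 * w 0) * m.coeff i (stdVec 0) (stdVec 1) (z, p.2) +
      v 1 * w 1 * m.coeff i (stdVec 1) (stdVec 1) (z, p.2) :=
    funext fun z => m.coeff_expand i v w (z, p.2)
  rw [e]
  refine (congrArg (fun l : Plane →L[ℝ] ℝ => l u) h.fderiv).trans ?_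
  simp

lemma coeffDeriv_expand_left (i : L.ι) (p : Plane × L.T i) (u v w : Plane) :
    m.coeffDeriv i u v w p = u 0 * m.coeffDeriv i (stdVec 0) v w p +
      u 1 * m.coeffDeriv i (stdVec 1) v w p := by
  unfold coeffDeriv
  conv_lhs => rw [plane_eq_sum u]
  simp

lemma christoffel_expand {i : L.ι} {p : Plane × L.T i} (hp : p ∈ (L.chart i).target)
    (u v w : Plane) :
    m.christoffel i u v w p = w 0 * m.christoffel i u v (stdVec 0) p +
      w 1 * m.christoffel i u v (stdVec 1) p := by
  unfold christoffel
  rw [m.coeffDeriv_expand hp u v w, m.coeffDeriv_expand hp v u w,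
    m.coeffDeriv_expand_left i p w, m.coeffDeriv_expand hp u v (stdVec 0),
    m.coeffDeriv_expand hp u v (stdVec 1), m.coeffDeriv_expand hp v u (stdVec 0),
    m.coeffDeriv_expand hp v u (stdVec 1)]
  simp [stdVec]
  ring

lemma christoffel_self_self (i : L.ι) (p : Plane × L.T i) (u : Plane) :
    m.christoffel i u u u p = m.coeffDeriv i u u u p / 2 := by
  unfold christoffel
  ring

lemma continuousOn_coeffDeriv (i : L.ι) (u v w : Plane) :
    ContinuousOn (m.coeffDeriv i u v w) (L.chart i).target := by
  have h := (m.smooth_coeff i v w).2 1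
  have h' := (continuousMultilinearCurryFin1 ℝ Plane ℝ).continuous.comp_continuousOn h
  refine (h'.clm_apply (continuousOn_const (c := u))).congr fun p _ => ?_
  simp [iteratedFDeriv_one_apply, coeffDeriv]
  rfl

lemma contDiffOn_coeffDeriv (i : L.ι) (u v w : Plane) (t : L.T i) :
    ContDiffOn ℝ ∞ (fun z => m.coeffDeriv i u v w (z, t)) {z | (z, t) ∈ (L.chart i).target} :=
  ((m.contDiffOn_coeff i v w t).fderiv_of_isOpen (m := ∞) (isOpen_slice i t) (by simp)).clm_apply
    contDiffOn_const

/-- The Gram determinant of the metric in the coordinates of the chart `i`. -/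
def gramDet (i : L.ι) (p : Plane × L.T i) : ℝ :=
  m.coeff i (stdVec 0) (stdVec 0) p * m.coeff i (stdVec 1) (stdVec 1) p -
    m.coeff i (stdVec 0) (stdVec 1) p ^ 2

lemma coeff_stdVec_pos {i : L.ι} {p : Plane × L.T i} (hp : p ∈ (L.chart i).target) (k : Fin 2) :
    0 < m.coeff i (stdVec k) (stdVec k) p :=
  m.coeff_self_pos hp (by simp [stdVec])

/-- Write `g₀₀`, `g₀₁` for the coefficients of the metric. The vector `g₀₀ e₁ - g₀₁ e₀` is nonzero
and its squared length is `g₀₀` times the Gram determinant. -/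
lemma gramDet_pos {i : L.ι} {p : Plane × L.T i} (hp : p ∈ (L.chart i).target) :
    0 < m.gramDet i p := by
  have h0 := m.coeff_stdVec_pos hp 0
  have hw : m.coeff i (stdVec 0) (stdVec 0) p • stdVec 1 +
      (-m.coeff i (stdVec 0) (stdVec 1) p) • stdVec 0 ≠ 0 := by
    intro h
    have := congrArg (fun v : Plane => v 1) h
    simp [stdVec] at this
    exact h0.ne' this
  have h := m.coeff_self_pos hp hw
  simp only [coeff_add_left, coeff_add_right, coeff_smul_left, coeff_smul_right] at h
  rw [m.coeff_comm i (stdVec 1) (stdVec 0)] at h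
  refine pos_of_mul_pos_right (a := m.coeff i (stdVec 0) (stdVec 0) p) ?_ h0.le
  unfold gramDet
  linarith

/-- The first coordinate of the acceleration of a geodesic. -/
def accelFst (i : L.ι) (p : Plane × L.T i) (u : Plane) : ℝ :=
  (m.christoffel i u u (stdVec 1) p * m.coeff i (stdVec 0) (stdVec 1) p -
    m.christoffel i u u (stdVec 0) p * m.coeff i (stdVec 1) (stdVec 1) p) / m.gramDet i p

/-- The second coordinate of the acceleration of a geodesic. -/
def accelSnd (i : L.ι) (p : Plane × L.T i) (u : Plane) : ℝ :=
  (m.christoffel i u u (stdVec 0) p * m.coeff i (stdVec 0) (stdVec 1) p -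
    m.christoffel i u u (stdVec 1) p * m.coeff i (stdVec 0) (stdVec 0) p) / m.gramDet i p

/-- The acceleration, in the coordinates of the chart `i`, of a geodesic with velocity `u`. -/
def accel (i : L.ι) (p : Plane × L.T i) (u : Plane) : Plane :=
  m.accelFst i p u • stdVec 0 + m.accelSnd i p u • stdVec 1

/-- Cramer's rule: `accelFst` and `accelSnd` solve the two linear equations obtained by pairing with
the basis vectors. -/
lemma coeff_accel {i : L.ι} {p : Plane × L.T i} (hp : p ∈ (L.chart i).target) (u w : Plane) :
    m.coeff i (m.accel i p u) w p + m.christoffel i u u w p = 0 := by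
  rw [m.christoffel_expand hp u u w, accel]
  conv_lhs => enter [1]; rw [plane_eq_sum w]
  simp only [coeff_add_left, coeff_add_right, coeff_smul_left, coeff_smul_right]
  rw [m.coeff_comm i (stdVec 1) (stdVec 0)]
  have hd := (m.gramDet_pos hp).ne'
  unfold accelFst accelSnd
  field_simp
  unfold gramDet
  ring

/-- Nondegeneracy of the metric makes the solution unique, so the paired form of the geodesic
equation is equivalent to an explicit second-order ODE. -/
lemma eq_accel {i : L.ι} {p : Plane × L.T i} (hp : p ∈ (L.chart i).target) {a u : Plane}
    (ha : ∀ w, m.coeff i a w p + m.christoffel i u u w p = 0) : a = m.accel i p u := by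
  by_contra hne
  have h := m.coeff_self_pos hp (sub_ne_zero.2 hne)
  have e : ∀ w, m.coeff i (a - m.accel i p u) w p = 0 := fun w => by
    have h1 := ha w
    have h2 := m.coeff_accel hp u w
    rw [sub_eq_add_neg, ← neg_one_smul ℝ, coeff_add_left, coeff_smul_left]
    linarith
  exact h.ne' (e _)

/-- Being a quadratic form in the velocity gives joint regularity in position and velocity, and
invariance under `u ↦ -u`, from which reversibility of geodesics follows. -/
lemma christoffel_quadratic {i : L.ι} {p : Plane × L.T i} (hp : p ∈ (L.chart i).target)
    (u w : Plane) :
    m.christoffel i u u w p = u 0 ^ 2 * m.christoffel i (stdVec 0) (stdVec 0) w p +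
      2 * (u 0 * u 1) * m.christoffel i (stdVec 0) (stdVec 1) w p +
      u 1 ^ 2 * m.christoffel i (stdVec 1) (stdVec 1) w p := by
  unfold christoffel
  rw [m.coeffDeriv_expand_left i p u u w, m.coeffDeriv_expand hp w u u,
    m.coeffDeriv_expand hp _ u w, m.coeffDeriv_expand hp _ u w,
    m.coeffDeriv_expand hp _ (stdVec 0) w, m.coeffDeriv_expand hp _ (stdVec 0) w,
    m.coeffDeriv_expand hp _ (stdVec 1) w, m.coeffDeriv_expand hp _ (stdVec 1) w]
  simp [stdVec]
  ring

lemma continuousOn_christoffel (i : L.ι) (u v w : Plane) :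
    ContinuousOn (m.christoffel i u v w) (L.chart i).target :=
  (((m.continuousOn_coeffDeriv i u v w).add (m.continuousOn_coeffDeriv i v u w)).sub
    (m.continuousOn_coeffDeriv i w u v)).div_const 2

lemma contDiffOn_christoffel (i : L.ι) (u v w : Plane) (t : L.T i) :
    ContDiffOn ℝ ∞ (fun z => m.christoffel i u v w (z, t)) {z | (z, t) ∈ (L.chart i).target} :=
  (((m.contDiffOn_coeffDeriv i u v w t).add (m.contDiffOn_coeffDeriv i v u w t)).sub
    (m.contDiffOn_coeffDeriv i w u v t)).div_const 2

lemma continuousOn_accel (i : L.ι) :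
    ContinuousOn (fun q : (Plane × L.T i) × Plane => m.accel i q.1 q.2)
      ((L.chart i).target ×ˢ univ) := by
  have hm : MapsTo Prod.fst ((L.chart i).target ×ˢ (univ : Set Plane)) (L.chart i).target :=
    fun q hq => hq.1
  have hg : ∀ v w, ContinuousOn (fun q : (Plane × L.T i) × Plane => m.coeff i v w q.1)
      ((L.chart i).target ×ˢ univ) := fun v w =>
    (m.continuousOn_coeff i v w).comp continuousOn_fst hm
  have hc : ∀ w, ContinuousOn (fun q : (Plane × L.T i) × Plane => m.christoffel i q.2 q.2 w q.1)
      ((L.chart i).target ×ˢ univ) := fun w => by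
    have k : ∀ a b, ContinuousOn (fun q : (Plane × L.T i) × Plane => m.christoffel i a b w q.1)
        ((L.chart i).target ×ˢ univ) := fun a b =>
      (m.continuousOn_christoffel i a b w).comp continuousOn_fst hm
    have k1 := k (stdVec 0) (stdVec 0)
    have k2 := k (stdVec 0) (stdVec 1)
    have k3 := k (stdVec 1) (stdVec 1)
    refine ContinuousOn.congr ?_ fun q hq => m.christoffel_quadratic hq.1 q.2 w
    fun_prop
  have hd : ContinuousOn (fun q : (Plane × L.T i) × Plane => m.gramDet i q.1)
      ((L.chart i).target ×ˢ univ) :=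
    ((hg _ _).mul (hg _ _)).sub ((hg _ _).pow 2)
  have hd0 : ∀ q ∈ (L.chart i).target ×ˢ (univ : Set Plane), m.gramDet i q.1 ≠ 0 :=
    fun q hq => (m.gramDet_pos hq.1).ne'
  exact (((((hc _).mul (hg _ _)).sub ((hc _).mul (hg _ _))).div hd hd0).smul
    continuousOn_const).add (((((hc _).mul (hg _ _)).sub ((hc _).mul (hg _ _))).div hd hd0).smul
    continuousOn_const)

lemma contDiffOn_accel (i : L.ι) (t : L.T i) :
    ContDiffOn ℝ ∞ (fun x : Plane × Plane => m.accel i (x.1, t) x.2)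
      {x | (x.1, t) ∈ (L.chart i).target} := by
  set D : Set (Plane × Plane) := {x | (x.1, t) ∈ (L.chart i).target}
  have hm : MapsTo Prod.fst D {z | (z, t) ∈ (L.chart i).target} := fun q hq => hq
  have hg : ∀ v w, ContDiffOn ℝ ∞ (fun x : Plane × Plane => m.coeff i v w (x.1, t)) D := fun v w =>
    (m.contDiffOn_coeff i v w t).comp contDiffOn_fst hm
  have hc : ∀ w, ContDiffOn ℝ ∞ (fun x : Plane × Plane => m.christoffel i x.2 x.2 w (x.1, t)) D :=
    fun w => by
    have k : ∀ a b, ContDiffOn ℝ ∞ (fun x : Plane × Plane => m.christoffel i a b w (x.1, t)) D :=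
      fun a b => (m.contDiffOn_christoffel i a b w t).comp contDiffOn_fst hm
    have hx : ∀ k : Fin 2, ContDiffOn ℝ ∞ (fun x : Plane × Plane => x.2 k) D := fun k => by
      fun_prop
    refine ContDiffOn.congr ?_ fun q hq => m.christoffel_quadratic hq q.2 w
    exact ((((hx 0).pow 2).mul (k _ _)).add ((contDiffOn_const.mul ((hx 0).mul (hx 1))).mul
      (k _ _))).add (((hx 1).pow 2).mul (k _ _))
  have hd : ContDiffOn ℝ ∞ (fun x : Plane × Plane => m.gramDet i (x.1, t)) D :=
    ((hg _ _).mul (hg _ _)).sub ((hg _ _).pow 2)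
  have hd0 : ∀ q ∈ D, m.gramDet i (q.1, t) ≠ 0 := fun q hq => (m.gramDet_pos hq).ne'
  exact (((((hc _).mul (hg _ _)).sub ((hc _).mul (hg _ _))).div hd hd0).smul
    contDiffOn_const).add (((((hc _).mul (hg _ _)).sub ((hc _).mul (hg _ _))).div hd hd0).smul
    contDiffOn_const)

/-- The geodesic vector field of the plaque `t` of the chart `i`, on positions and velocities. -/
def geodesicField (i : L.ι) (t : L.T i) (x : Plane × Plane) : Plane × Plane :=
  (x.2, m.accel i (x.1, t) x.2)

lemma contDiffOn_geodesicField (i : L.ι) (t : L.T i) :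
    ContDiffOn ℝ ∞ (m.geodesicField i t) {x | (x.1, t) ∈ (L.chart i).target} :=
  contDiffOn_snd.prodMk (m.contDiffOn_accel i t)

end SurfaceLamination.SmoothMetric

/-! ### Geodesics in a box of plaques: confinement and continuous dependence. -/

namespace SurfaceLamination.SmoothMetric

variable {X : Type*} [TopologicalSpace X] {L : SurfaceLamination X} (m : L.SmoothMetric)

/-- The curve `c` satisfies the geodesic equation near the time `s₀`, in every foliated chart. -/
def IsGeodesicAt (c : ℝ → m.UnitTangentBundle) (s₀ : ℝ) : Prop :=
  ∀ i : L.ι, (c s₀).1.proj ∈ (L.chart i).source →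
    ∀ᶠ s in 𝓝 s₀,
      (c s).1.proj ∈ (L.chart i).source ∧
      (L.chart i (c s).1.proj).2 = (L.chart i (c s₀).1.proj).2 ∧
      HasDerivAt (fun r => (L.chart i (c r).1.proj).1) (L.vectorCoord i (c s).1) s ∧
      ∃ a : Plane, HasDerivAt (fun r => L.vectorCoord i (c r).1) a s ∧
        ∀ w : Plane, m.coeff i a w (L.chart i (c s).1.proj) +
          m.christoffel i (L.vectorCoord i (c s).1) (L.vectorCoord i (c s).1) w
            (L.chart i (c s).1.proj) = 0

lemma isGeodesic_iff {c : ℝ → m.UnitTangentBundle} :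
    m.IsGeodesic c ↔ ∀ s, m.IsGeodesicAt c s := Iff.rfl

/-- Position and velocity of a unit tangent vector in the plaque coordinates of the chart `i`. -/
def state (i : L.ι) (y : m.UnitTangentBundle) : Plane × Plane :=
  ((L.chart i y.1.proj).1, L.vectorCoord i y.1)

variable {m}

lemma IsGeodesicAt.eventually_state {c : ℝ → m.UnitTangentBundle} {s₀ : ℝ}
    (h : m.IsGeodesicAt c s₀) {i : L.ι} (hi : (c s₀).1.proj ∈ (L.chart i).source) :
    ∀ᶠ s in 𝓝 s₀, (c s).1.proj ∈ (L.chart i).source ∧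
      (L.chart i (c s).1.proj).2 = (L.chart i (c s₀).1.proj).2 ∧
      HasDerivAt (fun r => m.state i (c r))
        (m.geodesicField i (L.chart i (c s).1.proj).2 (m.state i (c s))) s := by
  filter_upwards [h i hi] with s hs
  obtain ⟨h1, h2, h3, a, h4, h5⟩ := hs
  refine ⟨h1, h2, ?_⟩
  have ha := m.eq_accel ((L.chart i).map_source h1) h5
  rw [ha] at h4
  exact h3.prodMk h4

lemma IsGeodesicAt.eventually {c : ℝ → m.UnitTangentBundle} {s₀ : ℝ}
    (h : m.IsGeodesicAt c s₀) {i : L.ι} (hi : (c s₀).1.proj ∈ (L.chart i).source) :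
    ∀ᶠ s in 𝓝 s₀, (c s).1.proj ∈ (L.chart i).source ∧
      (L.chart i (c s).1.proj).2 = (L.chart i (c s₀).1.proj).2 :=
  (h.eventually_state hi).mono fun _ hs => ⟨hs.1, hs.2.1⟩

lemma IsGeodesicAt.hasDerivAt_state {c : ℝ → m.UnitTangentBundle} {s : ℝ}
    (h : m.IsGeodesicAt c s) {i : L.ι} (hi : (c s).1.proj ∈ (L.chart i).source) :
    HasDerivAt (fun r => m.state i (c r))
        (m.geodesicField i (L.chart i (c s).1.proj).2 (m.state i (c s))) s :=
  (h.eventually_state hi).self_of_nhds.2.2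

/-- Position and velocity are differentiable, and the transverse coordinate, about whose space
nothing metric is known, is locally constant. -/
lemma IsGeodesicAt.continuousAt {c : ℝ → m.UnitTangentBundle} {s : ℝ}
    (h : m.IsGeodesicAt c s) : ContinuousAt c s := by
  obtain ⟨i, hi⟩ := L.cover (c s).1.proj
  have hs := (h.hasDerivAt_state hi).continuousAt
  refine (m.tendsto_iff_of_mem hi).2 ⟨(h.eventually hi).mono fun _ h => h.1, ?_, hs.snd⟩
  have h1 : ContinuousAt (fun r => ((L.chart i (c r).1.proj).1, (L.chart i (c s).1.proj).2)) s :=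
    hs.fst.prodMk continuousAt_const
  refine h1.tendsto.congr' ((h.eventually hi).mono fun r hr => ?_)
  exact Prod.ext rfl hr.2.symm

variable (m)

/-- A box of plaques in the chart `i` around the plaque disk of centre `z₀` and radius `2 r`, with
transversal `T₀`, on which the unit vectors have coordinates of norm less than `C`. -/
structure IsPlaqueBox (i : L.ι) (z₀ : Plane) (r C : ℝ) (T₀ : Set (L.T i)) : Prop where
  radius_pos : 0 < r
  bound_pos : 0 < C
  mem_target : ∀ z ∈ Metric.closedBall z₀ (2 * r), ∀ t ∈ T₀, (z, t) ∈ (L.chart i).target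
  norm_lt : ∀ z ∈ Metric.closedBall z₀ (2 * r), ∀ t ∈ T₀, ∀ u : Plane,
    m.coeff i u u (z, t) = 1 → ‖u‖ < C

/-- By compactness of the Euclidean unit circle the metric has a positive minimum there at the
centre, and half of this bound persists nearby. Homogeneity turns it into a bound on the coordinates
of unit vectors. -/
lemma exists_isPlaqueBox {i : L.ι} {z₀ : Plane} {t₀ : L.T i}
    (h : (z₀, t₀) ∈ (L.chart i).target) :
    ∃ r C T₀, T₀ ∈ 𝓝 t₀ ∧ m.IsPlaqueBox i z₀ r C T₀ := by
  have hS := isCompact_sphere (0 : Plane) 1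
  have hcont : ∀ q : (Plane × L.T i) × Plane, q.1 ∈ (L.chart i).target →
      ContinuousAt (fun q : (Plane × L.T i) × Plane => m.coeff i q.2 q.2 q.1) q := fun q hq =>
    m.continuousAt_coeff continuousAt_fst continuousAt_snd continuousAt_snd hq
  obtain ⟨μ, hμ, hmin⟩ := hS.exists_forall_le' (f := fun u => m.coeff i u u (z₀, t₀)) (a := 0)
    (fun u _ => (ContinuousAt.comp (f := fun u : Plane => ((z₀, t₀), u)) (hcont ((z₀, t₀), u) h)
      (by fun_prop)).continuousWithinAt)
    (fun u hu => m.coeff_self_pos h (by rintro rfl; simp at hu))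
  have hev : ∀ᶠ p in 𝓝 (z₀, t₀), ∀ u ∈ Metric.sphere (0 : Plane) 1, μ / 2 < m.coeff i u u p := by
    refine hS.eventually_forall_of_forall_eventually fun u hu => ?_
    exact (hcont ((z₀, t₀), u) h).eventually (lt_mem_nhds (by linarith [hmin u hu]))
  have hall := hev.and ((L.chart i).open_target.mem_nhds h)
  obtain ⟨V, hV, T₀, hT₀, hsub⟩ := mem_nhds_prod_iff.1 hall
  obtain ⟨ρ, hρ, hball⟩ := Metric.nhds_basis_closedBall.mem_iff.1 hV
  -- If `‖u‖` were at least `1` and at least `2 / μ`, then `μ / 2 * ‖u‖ ^ 2 ≥ ‖u‖ ≥ 1`, against the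
  -- lower bound on the metric.
  refine ⟨ρ / 2, max 1 (2 / μ), T₀, hT₀, by positivity, by positivity, ?_, ?_⟩
  · intro z hz t ht
    exact (hsub (mk_mem_prod (hball (by simpa [mul_div_cancel₀] using hz)) ht)).2
  · intro z hz t ht u hu
    have hb := (hsub (mk_mem_prod (hball (by simpa [mul_div_cancel₀] using hz)) ht)).1
    by_contra hle
    rw [not_lt] at hle
    have h1 : 1 ≤ ‖u‖ := (le_max_left _ _).trans hle
    have h2 : 2 / μ ≤ ‖u‖ := (le_max_right _ _).trans hle
    have h0 : (0 : ℝ) < ‖u‖ := by linarith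
    have h3 := hb (‖u‖⁻¹ • u) (by simp [norm_smul, h0.ne'])
    rw [coeff_smul_left, coeff_smul_right, hu] at h3
    have h4 : μ / 2 * (‖u‖ * ‖u‖) < 1 := by
      calc μ / 2 * (‖u‖ * ‖u‖) < (‖u‖⁻¹ * (‖u‖⁻¹ * 1)) * (‖u‖ * ‖u‖) := by gcongr
        _ = 1 := by field_simp
    have h5 : 2 ≤ ‖u‖ * μ := (div_le_iff₀ hμ).1 h2
    nlinarith

variable {m}

lemma IsPlaqueBox.norm_vectorCoord_lt {i : L.ι} {z₀ : Plane} {r C : ℝ} {T₀ : Set (L.T i)}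
    (hB : m.IsPlaqueBox i z₀ r C T₀) {y : m.UnitTangentBundle}
    (hy : y.1.proj ∈ (L.chart i).source) (hz : (L.chart i y.1.proj).1 ∈ Metric.closedBall z₀ (2 * r))
    (ht : (L.chart i y.1.proj).2 ∈ T₀) : ‖L.vectorCoord i y.1‖ < C :=
  hB.norm_lt _ hz _ ht _ (m.coeff_vectorCoord_self y hy)

/-- A curve of coordinate speed below `C` moves at most `r` in time `r / C`. The speed bound is
available only inside the box, so confinement is proved by continuation along the time interval. -/
lemma IsPlaqueBox.geodesic_mem [T2Space X] {i : L.ι} {z₀ : Plane} {r C : ℝ} {T₀ : Set (L.T i)}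
    (hB : m.IsPlaqueBox i z₀ r C T₀) {c : ℝ → m.UnitTangentBundle} {τ : ℝ} (hτ : τ ≤ r / C)
    (hc : ∀ s ∈ Icc 0 τ, m.IsGeodesicAt c s) (hi : (c 0).1.proj ∈ (L.chart i).source)
    (hz : (L.chart i (c 0).1.proj).1 ∈ Metric.closedBall z₀ r)
    (ht : (L.chart i (c 0).1.proj).2 ∈ T₀) :
    ∀ s ∈ Icc 0 τ, (c s).1.proj ∈ (L.chart i).source ∧
      (L.chart i (c s).1.proj).2 = (L.chart i (c 0).1.proj).2 ∧
      (L.chart i (c s).1.proj).1 ∈ Metric.closedBall z₀ (2 * r) := by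
  have hr := hB.radius_pos
  have hC := hB.bound_pos
  set t := (L.chart i (c 0).1.proj).2
  set x₀ := (L.chart i (c 0).1.proj).1
  have htwo : ∀ s ∈ Icc 0 τ, ∀ x : Plane, dist x x₀ ≤ C * s → x ∈ Metric.closedBall z₀ (2 * r) := by
    intro s hs x hx
    have h1 : C * s ≤ r := by
      calc C * s ≤ C * (r / C) := by gcongr; exact hs.2.trans hτ
        _ = r := by field_simp
    have := dist_triangle x x₀ z₀
    rw [Metric.mem_closedBall] at hz ⊢
    linarith
  set S : Set ℝ := {s | (c s).1.proj ∈ (L.chart i).source ∧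
      (L.chart i (c s).1.proj).2 = t ∧ dist (L.chart i (c s).1.proj).1 x₀ ≤ C * s}
  suffices hsub : Icc 0 τ ⊆ S from fun s hs => by
    obtain ⟨h1, h2, h3⟩ := hsub hs
    exact ⟨h1, h2, htwo s hs _ h3⟩
  have hcont : ContinuousOn c (Icc 0 τ) := fun s hs => (hc s hs).continuousAt.continuousWithinAt
  refine IsClosed.Icc_subset_of_forall_exists_gt ?_ ⟨hi, rfl, by simp [x₀]⟩ ?_
  -- Closedness of the good times: the chart domain is only open, but the closed plaque disk is
  -- compact, hence closed in the Hausdorff space `X`, so the limit point stays in the chart and in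
  -- the same plaque.
  · set Q : Set X := (fun z => (L.chart i).symm (z, t)) '' Metric.closedBall z₀ (2 * r) with hQ
    have hQc : IsClosed Q := by
      refine (IsCompact.image_of_continuousOn (isCompact_closedBall _ _) ?_).isClosed
      exact (L.chart i).continuousOn_symm.comp (by fun_prop) fun z hz => hB.mem_target z hz t ht
    have hQs : Q ⊆ (L.chart i).source := by
      rintro _ ⟨z, hz, rfl⟩
      exact (L.chart i).map_target (hB.mem_target z hz t ht)
    rw [← isSeqClosed_iff_isClosed]
    intro f s hf hfs
    have hs : s ∈ Icc 0 τ := isClosed_Icc.mem_of_tendsto hfs (Eventually.of_forall fun n => (hf n).2)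
    have hcs : Tendsto (fun n => c (f n)) atTop (𝓝 (c s)) :=
      (hc s hs).continuousAt.tendsto.comp hfs
    have hmem : (c s).1.proj ∈ Q := by
      refine hQc.mem_of_tendsto ((m.continuous_proj.tendsto _).comp hcs)
        (Eventually.of_forall fun n => ?_)
      obtain ⟨⟨h1, h2, h3⟩, h4⟩ := hf n
      refine ⟨_, htwo _ h4 _ h3, ?_⟩
      dsimp only
      rw [← h2, Prod.mk.eta, (L.chart i).left_inv h1]
      rfl
    have hsi := hQs hmem
    have ht' : (L.chart i (c s).1.proj).2 = t := by
      obtain ⟨z, hz, hzs⟩ := hmem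
      rw [← hzs, (L.chart i).right_inv (hB.mem_target z hz t ht)]
    refine ⟨⟨hsi, ht', ?_⟩, hs⟩
    have h5 := ((m.continuousAt_coord hsi).1.fst.tendsto).comp hcs
    exact le_of_tendsto_of_tendsto (h5.dist tendsto_const_nhds) (hfs.const_mul C)
      (Eventually.of_forall fun n => (hf n).1.2.2)
  · rintro s ⟨⟨h1, h2, h3⟩, h4⟩ y hy
    have hs : s ∈ Icc 0 τ := ⟨h4.1, h4.2.le⟩
    have hsp : ‖L.vectorCoord i (c s).1‖ < C :=
      hB.norm_vectorCoord_lt h1 (htwo s hs _ h3) (by rw [h2]; exact ht)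
    have hd : HasDerivAt (fun r => (L.chart i (c r).1.proj).1) (L.vectorCoord i (c s).1) s :=
      ((hc s hs) i h1).self_of_nhds.2.2.1
    -- The strict bound on the velocity passes to difference quotients over short intervals, which
    -- extends the estimate past `s`.
    have hlt := (hasDerivAt_iff_tendsto_slope.1 hd).norm.eventually (gt_mem_nhds hsp)
    have hlt' : ∀ᶠ b in 𝓝[>] s, ‖slope (fun r => (L.chart i (c r).1.proj).1) s b‖ < C :=
      hlt.filter_mono (nhdsWithin_mono _ fun x (hx : s < x) => hx.ne')
    have hev := ((hc s hs).eventually h1).filter_mono (nhdsWithin_le_nhds (s := Ioi s))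
    have hIoc : ∀ᶠ b in 𝓝[>] s, b ∈ Ioc s y := Ioc_mem_nhdsGT hy
    obtain ⟨b, hb1, hb2, hb3⟩ := (hlt'.and (hev.and hIoc)).exists
    refine ⟨b, ⟨hb2.1, hb2.2.trans h2, ?_⟩, hb3⟩
    have hsb : 0 < b - s := by linarith [hb3.1]
    rw [slope_def_module, norm_smul, norm_inv, Real.norm_of_nonneg hsb.le, ← dist_eq_norm,
      inv_mul_lt_iff₀ hsb] at hb1
    have := dist_triangle (L.chart i (c b).1.proj).1 (L.chart i (c s).1.proj).1 x₀
    linarith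

lemma IsPlaqueBox.exists_lipschitzOnWith {i : L.ι} {z₀ : Plane} {r C : ℝ} {T₀ : Set (L.T i)}
    (hB : m.IsPlaqueBox i z₀ r C T₀) {t : L.T i} (ht : t ∈ T₀) (R : ℝ) :
    ∃ K, LipschitzOnWith K (m.geodesicField i t)
      (Metric.closedBall z₀ (2 * r) ×ˢ Metric.closedBall 0 R) := by
  refine LocallyLipschitzOn.exists_lipschitzOnWith_of_compact
    ((isCompact_closedBall _ _).prod (isCompact_closedBall _ _)) ?_
  refine ContDiffOn.locallyLipschitzOn ((convex_closedBall _ _).prod (convex_closedBall _ _)) ?_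
  exact ((m.contDiffOn_geodesicField i t).mono fun x hx => hB.mem_target _ hx.1 _ ht).of_le (by simp)

/-- A tube argument: joint continuity of the field and compactness in position and velocity give
uniform closeness of the fields on neighbouring plaques. -/
lemma IsPlaqueBox.eventually_dist_geodesicField_lt {i : L.ι} {z₀ : Plane} {r C : ℝ}
    {T₀ : Set (L.T i)} (hB : m.IsPlaqueBox i z₀ r C T₀) {t : L.T i} (ht : t ∈ T₀) (R : ℝ)
    {η : ℝ} (hη : 0 < η) :
    ∀ᶠ t' in 𝓝 t, ∀ x ∈ Metric.closedBall z₀ (2 * r) ×ˢ Metric.closedBall (0 : Plane) R,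
      dist (m.geodesicField i t' x) (m.geodesicField i t x) < η := by
  refine ((isCompact_closedBall _ _).prod
    (isCompact_closedBall _ _)).eventually_forall_of_forall_eventually fun x hx => ?_
  have hx' := hB.mem_target _ hx.1 _ ht
  have h1 : ContinuousAt (fun q : L.T i × (Plane × Plane) => m.geodesicField i q.1 q.2) (t, x) := by
    refine ContinuousAt.prodMk (by fun_prop) ?_
    refine ContinuousAt.comp (f := fun q : L.T i × (Plane × Plane) => ((q.2.1, q.1), q.2.2))
      (g := fun q : (Plane × L.T i) × Plane => m.accel i q.1 q.2) ?_ (by fun_prop)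
    exact (m.continuousOn_accel i).continuousAt
      (((L.chart i).open_target.prod isOpen_univ).mem_nhds ⟨hx', trivial⟩)
  have h2 : ContinuousAt (fun q : L.T i × (Plane × Plane) => m.geodesicField i t q.2) (t, x) := by
    refine ContinuousAt.comp (f := fun q : L.T i × (Plane × Plane) => q.2)
      (g := m.geodesicField i t) ?_ (by fun_prop)
    exact (m.contDiffOn_geodesicField i t).continuousOn.continuousAt
      (((isOpen_slice i t).preimage continuous_fst).mem_nhds hx')
  have h3 := h1.dist h2
  exact h3.eventually (gt_mem_nhds (by simpa using hη))

/-- A single `δ` serves both as the initial error and as the error of the vector field; the bound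
vanishes continuously as `δ` tends to zero. -/
lemma exists_gronwallBound_lt {K : ℝ} (hK : 0 < K) (x : ℝ) {η : ℝ} (hη : 0 < η) :
    ∃ δ > 0, gronwallBound δ K δ x < η := by
  have hc : Continuous fun δ => gronwallBound δ K δ x := by
    simp only [gronwallBound_of_K_ne_0 hK.ne']
    fun_prop
  have h0 : ∀ᶠ δ in 𝓝 (0 : ℝ), gronwallBound δ K δ x < η :=
    hc.continuousAt.eventually (gt_mem_nhds (by simpa [gronwallBound_ε0_δ0] using hη))
  have h1 : ∀ᶠ δ in 𝓝[>] (0 : ℝ), gronwallBound δ K δ x < η := h0.filter_mono nhdsWithin_le_nhds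
  obtain ⟨δ, h, hδ⟩ := (h1.and self_mem_nhdsWithin).exists
  exact ⟨δ, hδ, h⟩

/-- Geodesics of a plaque box which start near to each other stay near to each other. -/
lemma IsPlaqueBox.exists_dist_state_lt [T2Space X] {i : L.ι} {z₀ : Plane} {r C : ℝ}
    {T₀ : Set (L.T i)} (hB : m.IsPlaqueBox i z₀ r C T₀) {t : L.T i} (ht : t ∈ T₀)
    {η : ℝ} (hη : 0 < η) :
    ∃ δ > 0, ∀ᶠ t' in 𝓝 t, t' ∈ T₀ → ∀ τ ≤ r / C, ∀ c c' : ℝ → m.UnitTangentBundle,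
      (∀ s ∈ Icc 0 τ, m.IsGeodesicAt c s) → (∀ s ∈ Icc 0 τ, m.IsGeodesicAt c' s) →
      (c 0).1.proj ∈ (L.chart i).source → (c' 0).1.proj ∈ (L.chart i).source →
      (L.chart i (c 0).1.proj).1 ∈ Metric.closedBall z₀ r →
      (L.chart i (c' 0).1.proj).1 ∈ Metric.closedBall z₀ r →
      (L.chart i (c 0).1.proj).2 = t → (L.chart i (c' 0).1.proj).2 = t' →
      dist (m.state i (c' 0)) (m.state i (c 0)) < δ →
      ∀ s ∈ Icc 0 τ, dist (m.state i (c' s)) (m.state i (c s)) < η := by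
  obtain ⟨K, hK⟩ := hB.exists_lipschitzOnWith ht C
  set K' : NNReal := K + 1
  have hK' := hK.weaken (show K ≤ K' by simp [K'])
  obtain ⟨δ, hδ, hbound⟩ := exists_gronwallBound_lt (K := K') (by positivity) (r / C) hη
  refine ⟨δ, hδ, ?_⟩
  filter_upwards [hB.eventually_dist_geodesicField_lt ht C hδ] with t' hfield ht' τ hτ c c' hc hc'
    hi hi' hz hz' hct hct' hdist s hs
  have hmem : ∀ c : ℝ → m.UnitTangentBundle, (∀ s ∈ Icc 0 τ, m.IsGeodesicAt c s) →
      (c 0).1.proj ∈ (L.chart i).source → (L.chart i (c 0).1.proj).1 ∈ Metric.closedBall z₀ r →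
      (L.chart i (c 0).1.proj).2 ∈ T₀ → ∀ s ∈ Icc 0 τ,
      m.state i (c s) ∈ Metric.closedBall z₀ (2 * r) ×ˢ Metric.closedBall (0 : Plane) C ∧
      HasDerivAt (fun r => m.state i (c r))
        (m.geodesicField i (L.chart i (c 0).1.proj).2 (m.state i (c s))) s := by
    intro c hc hi hz ht s hs
    obtain ⟨h1, h2, h3⟩ := hB.geodesic_mem hτ hc hi hz ht s hs
    refine ⟨⟨h3, ?_⟩, h2 ▸ (hc s hs).hasDerivAt_state h1⟩
    rw [mem_closedBall_zero_iff]
    exact (hB.norm_vectorCoord_lt h1 h3 (h2 ▸ ht)).le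
  have k := hmem c hc hi hz (hct ▸ ht)
  have k' := hmem c' hc' hi' hz' (hct' ▸ ht')
  rw [hct] at k
  rw [hct'] at k'
  have hIco : Ico 0 τ ⊆ Icc 0 τ := Ico_subset_Icc_self
  have hG := dist_le_of_approx_trajectories_ODE_of_mem (K := K') (v := fun _ => m.geodesicField i t)
    (s := fun _ => Metric.closedBall z₀ (2 * r) ×ˢ Metric.closedBall (0 : Plane) C)
    (f := fun s => m.state i (c' s)) (g := fun s => m.state i (c s)) (a := 0) (b := τ)
    (f' := fun s => m.geodesicField i t' (m.state i (c' s)))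
    (g' := fun s => m.geodesicField i t (m.state i (c s))) (εf := δ) (εg := 0) (δ := δ)
    (fun _ _ => hK') (fun s hs => (k' s hs).2.continuousAt.continuousWithinAt)
    (fun s hs => (k' s (hIco hs)).2.hasDerivWithinAt)
    (fun s hs => (hfield _ (k' s (hIco hs)).1).le) (fun s hs => (k' s (hIco hs)).1)
    (fun s hs => (k s hs).2.continuousAt.continuousWithinAt)
    (fun s hs => (k s (hIco hs)).2.hasDerivWithinAt)
    (fun s hs => by simp) (fun s hs => (k s (hIco hs)).1) hdist.le s hs
  refine (hG.trans ?_).trans_lt hbound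
  simp only [add_zero, sub_zero]
  exact gronwallBound_mono hδ.le hδ.le (by positivity) (hs.2.trans hτ)

variable (m)

/-- Local continuous dependence of geodesics on the initial vector. -/
lemma exists_nhds_geodesic_dependence [T2Space X] (v : m.UnitTangentBundle) :
    ∃ U ∈ 𝓝 v, ∃ ε > 0, ∀ τ ≤ ε, ∀ c : ℝ → m.UnitTangentBundle, c 0 ∈ U →
      (∀ s ∈ Icc 0 τ, m.IsGeodesicAt c s) → ∀ s₀ ∈ Icc 0 τ, ∀ W ∈ 𝓝 (c s₀),
      ∀ᶠ q : ℝ × m.UnitTangentBundle in 𝓝 (s₀, c 0), q.1 ∈ Icc 0 τ →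
        ∀ c' : ℝ → m.UnitTangentBundle, (∀ s ∈ Icc 0 τ, m.IsGeodesicAt c' s) → c' 0 = q.2 →
          c' q.1 ∈ W := by
  obtain ⟨i, hi⟩ := L.cover v.1.proj
  obtain ⟨r, C, T₀, hT₀, hB⟩ := m.exists_isPlaqueBox ((L.chart i).map_source hi)
  set z₀ := (L.chart i v.1.proj).1
  have hUi : ∀ w : m.UnitTangentBundle, w.1.proj ∈ (L.chart i).source →
      ∀ᶠ w' in 𝓝 w, w'.1.proj ∈ (L.chart i).source := fun w hw =>
    m.continuous_proj.continuousAt.eventually ((L.chart i).open_source.mem_nhds hw)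
  have hU : {w : m.UnitTangentBundle | w.1.proj ∈ (L.chart i).source ∧
      (L.chart i w.1.proj).1 ∈ Metric.ball z₀ r ∧ (L.chart i w.1.proj).2 ∈ T₀} ∈ 𝓝 v := by
    filter_upwards [hUi v hi, (m.continuousAt_coord hi).1.fst.eventually
      (Metric.ball_mem_nhds z₀ hB.radius_pos), (m.continuousAt_coord hi).1.snd.eventually hT₀]
      with w h1 h2 h3 using ⟨h1, h2, h3⟩
  -- `T₀` is merely a neighbourhood of the transverse coordinate, so `U` is taken to consist of the
  -- interior points of the box: each point of `U` then has the whole box as a neighbourhood.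
  rw [← eventually_mem_set, ← eventually_eventually_nhds] at hU
  refine ⟨_, hU, r / C, div_pos hB.radius_pos hB.bound_pos, ?_⟩
  intro τ hτ c hcU hc s₀ hs₀ W hW
  obtain ⟨h1, h2, h3⟩ := mem_of_mem_nhds hcU
  obtain ⟨k1, k2, k3⟩ := hB.geodesic_mem hτ hc h1 (Metric.ball_subset_closedBall h2) h3 s₀ hs₀
  -- `W` contains every vector over the chart whose transverse coordinate and state are near those
  -- of `c s₀`. It remains to control these two data for `c'` at a nearby time.
  have hW' : ∀ᶠ q in 𝓝 ((L.chart i (c s₀).1.proj).2, m.state i (c s₀)),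
      ∀ y : m.UnitTangentBundle, y.1.proj ∈ (L.chart i).source →
        ((L.chart i y.1.proj).2, m.state i y) = q → y ∈ W := by
    have e : W ∈ comap (fun y : m.UnitTangentBundle => ((L.chart i y.1.proj).2, m.state i y))
        (𝓝 ((L.chart i (c s₀).1.proj).2, m.state i (c s₀))) ⊓
        𝓟 {y | y.1.proj ∈ (L.chart i).source} := by
      have hid : Tendsto id (comap
          (fun y : m.UnitTangentBundle => ((L.chart i y.1.proj).2, m.state i y))
        (𝓝 ((L.chart i (c s₀).1.proj).2, m.state i (c s₀))) ⊓
        𝓟 {y | y.1.proj ∈ (L.chart i).source}) (𝓝 (c s₀)) := by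
        have hq : Tendsto (fun y : m.UnitTangentBundle => ((L.chart i y.1.proj).2, m.state i y))
            (comap (fun y : m.UnitTangentBundle => ((L.chart i y.1.proj).2, m.state i y))
          (𝓝 ((L.chart i (c s₀).1.proj).2, m.state i (c s₀))) ⊓
          𝓟 {y | y.1.proj ∈ (L.chart i).source})
          (𝓝 ((L.chart i (c s₀).1.proj).2, m.state i (c s₀))) :=
          tendsto_comap.mono_left inf_le_left
        refine (m.tendsto_iff_of_mem k1).2 ⟨mem_inf_of_right (mem_principal_self _), ?_, ?_⟩
        · exact (((continuous_fst.comp continuous_snd).prodMk continuous_fst).tendsto _).comp hq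
        · exact ((continuous_snd.comp continuous_snd).tendsto _).comp hq
      exact hid hW
    rw [mem_inf_principal, mem_comap] at e
    obtain ⟨V, hV, hVW⟩ := e
    filter_upwards [hV] with q hq y hy hyq
    subst hyq
    exact hVW hq hy
  rw [nhds_prod_eq] at hW'
  obtain ⟨P, hP, R, hR, hPR⟩ := eventually_prod_iff.1 hW'
  obtain ⟨η, hη, hball⟩ := Metric.eventually_nhds_iff.1 hR
  obtain ⟨δ, hδ, hdep⟩ := hB.exists_dist_state_lt h3 (half_pos hη)
  have hst : ContinuousAt (fun y => m.state i y) (c 0) :=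
    (m.continuousAt_coord h1).1.fst.prodMk (m.continuousAt_coord h1).2
  have hs0 : ContinuousAt (fun s => m.state i (c s)) s₀ :=
    ((hc s₀ hs₀).hasDerivAt_state k1).continuousAt
  rw [k2] at hP
  have hws := (hcU.and (((m.continuousAt_coord h1).1.snd.eventually hdep).and
    (((m.continuousAt_coord h1).1.snd.eventually hP).and
    (hst.eventually (Metric.ball_mem_nhds _ hδ)))))
  rw [nhds_prod_eq]
  filter_upwards [(hs0.eventually (Metric.ball_mem_nhds _ (half_pos hη))).prod_mk hws]
  rintro ⟨s, w⟩ ⟨hs, hw, hw1, hw2, hw3⟩ hsm c' hc' rfl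
  obtain ⟨l1, l2, l3⟩ := hw
  obtain ⟨n1, n2, n3⟩ := hB.geodesic_mem hτ hc' l1 (Metric.ball_subset_closedBall l2) l3 s hsm
  have hd := hw1 l3 τ hτ c c' hc hc' h1 l1 (Metric.ball_subset_closedBall h2)
    (Metric.ball_subset_closedBall l2) rfl rfl hw3 s hsm
  refine hPR (x := (L.chart i (c' s).1.proj).2) (by rw [n2]; exact hw2)
    (y := m.state i (c' s)) (hball ?_) _ n1 rfl
  -- One half of `η` accounts for changing the geodesic at time `s`, the other for moving along `c`
  -- from `s` to `s₀`.
  have := dist_triangle (m.state i (c' s)) (m.state i (c s)) (m.state i (c s₀))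
  have hs' : dist (m.state i (c s)) (m.state i (c s₀)) < η / 2 := hs
  linarith

end SurfaceLamination.SmoothMetric

/-! ### Invariance of the geodesic equation under changes of chart. -/

namespace SurfaceLamination.SmoothMetric

variable {X : Type*} [TopologicalSpace X] {L : SurfaceLamination X} (m : L.SmoothMetric)

/-- The product rule for the metric along a curve in a plaque. -/
lemma hasDerivAt_coeff {i : L.ι} {t : L.T i} {z v w : ℝ → Plane} {z₀ v₀ w₀ z' v' w' : Plane}
    {s : ℝ} (hz₀ : z s = z₀) (hv₀ : v s = v₀) (hw₀ : w s = w₀) (hs : (z₀, t) ∈ (L.chart i).target) (hz : HasDerivAt z z' s) (hv : HasDerivAt v v' s)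
    (hw : HasDerivAt w w' s) :
    HasDerivAt (fun r => m.coeff i (v r) (w r) (z r, t))
      (m.coeffDeriv i z' v₀ w₀ (z₀, t) + m.coeff i v' w₀ (z₀, t) + m.coeff i v₀ w' (z₀, t)) s := by
  subst hz₀ hv₀ hw₀
  have hco : ∀ {f : ℝ → Plane} {f' : Plane}, HasDerivAt f f' s → ∀ k : Fin 2,
      HasDerivAt (fun r => f r k) (f' k) s := fun hf k =>
    ((EuclideanSpace.proj (𝕜 := ℝ) k).hasFDerivAt.comp_hasDerivAt s hf)
  have hg : ∀ a b, HasDerivAt (fun r => m.coeff i a b (z r, t))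
      (m.coeffDeriv i z' a b (z s, t)) s := fun a b =>
    (m.differentiableAt_coeff hs a b).hasFDerivAt.comp_hasDerivAt s hz
  have e : (fun r => m.coeff i (v r) (w r) (z r, t)) = _ :=
    funext fun r => m.coeff_expand i (v r) (w r) (z r, t)
  rw [e]
  have h := (((hco hv 0).mul (hco hw 0)).mul (hg (stdVec 0) (stdVec 0))).add
    ((((hco hv 0).mul (hco hw 1)).add ((hco hv 1).mul (hco hw 0))).mul
      (hg (stdVec 0) (stdVec 1)))
  have h' := h.add (((hco hv 1).mul (hco hw 1)).mul (hg (stdVec 1) (stdVec 1)))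
  refine h'.congr_deriv ?_
  rw [m.coeffDeriv_expand hs z' (v s) (w s), m.coeff_expand i v' (w s), m.coeff_expand i (v s) w']
  simp only [Pi.mul_apply, Pi.add_apply]
  ring

/-- The coordinate change between the plaques through `x` of the charts `i` and `j`. -/
def transition (L : SurfaceLamination X) (i j : L.ι) (x : X) (z : Plane) : Plane :=
  (L.chart j ((L.chart i).symm (z, (L.chart i x).2))).1

lemma contDiffAt_transition {i j : L.ι} {x : X} (hi : x ∈ (L.chart i).source)
    (hj : x ∈ (L.chart j).source) :
    ContDiffAt ℝ ∞ (transition L i j x) (L.chart i x).1 :=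
  ((L.smooth i j).1 (L.chart i x).2).contDiffAt (L.eventually_overlap hi hj)

lemma transition_chart {i j : L.ι} {x y : X} (hy : y ∈ (L.chart i).source)
    (hxy : (L.chart i y).2 = (L.chart i x).2) :
    transition L i j x (L.chart i y).1 = (L.chart j y).1 := by
  rw [transition, ← hxy, Prod.mk.eta, (L.chart i).left_inv hy]

lemma coordChange_eq_fderiv_transition {i j : L.ι} {x y : X}
    (hxy : (L.chart i y).2 = (L.chart i x).2) :
    L.coordChange i j y = fderiv ℝ (transition L i j x) (L.chart i y).1 := by
  rw [coordChange, hxy]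
  rfl

lemma hasFDerivAt_fderiv_transition {i j : L.ι} {x : X} (hi : x ∈ (L.chart i).source)
    (hj : x ∈ (L.chart j).source) :
    HasFDerivAt (fderiv ℝ (transition L i j x))
      (fderiv ℝ (fderiv ℝ (transition L i j x)) (L.chart i x).1) (L.chart i x).1 :=
  (((contDiffAt_transition hi hj).fderiv_right (m := ∞) (by simp)).differentiableAt
    (by simp)).hasFDerivAt

lemma coeff_eq_coeff_transition {i j : L.ι} {x : X} {z : Plane}
    (hx : x ∈ (L.chart i).source ∩ (L.chart j).source)
    (hz : (z, (L.chart i x).2) ∈ ((L.chart i).symm.trans (L.chart j)).source) (v w : Plane) :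
    m.coeff i v w (z, (L.chart i x).2) =
      m.coeff j (fderiv ℝ (transition L i j x) z v) (fderiv ℝ (transition L i j x) z w)
        (transition L i j x z, (L.chart j x).2) := by
  have hz1 : (z, (L.chart i x).2) ∈ (L.chart i).target := by simpa using hz.1
  set y := (L.chart i).symm (z, (L.chart i x).2) with hy
  have hyj : y ∈ (L.chart j).source := by simpa using hz.2
  have hyi : y ∈ (L.chart i).source := (L.chart i).map_target hz1
  have hyc : L.chart i y = (z, (L.chart i x).2) := (L.chart i).right_inv hz1
  have h2 : (L.chart i y).2 = (L.chart i x).2 := by rw [hyc]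
  have hc := coordChange_eq_fderiv_transition (j := j) h2
  have ht := transition_chart (j := j) hyi h2
  rw [hyc] at hc ht
  dsimp only at hc ht
  rw [← hyc, ← hc, ht, ← L.transverse i j y ⟨hyi, hyj⟩ x hx h2, Prod.mk.eta, m.coeff_chart hyi,
    m.coeff_chart hyj, L.vectorOfCoord_coordChange hyi hyj, L.vectorOfCoord_coordChange hyi hyj]

/-- Differentiate `coeff_eq_coeff_transition` along the line `z₀ + s u`. The vectors fixed in chart
`i` vary in chart `j` through the derivative of the transition map, which produces the
second-derivative terms. -/
lemma coeffDeriv_transition {i j : L.ι} {x : X} (hi : x ∈ (L.chart i).source)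
    (hj : x ∈ (L.chart j).source) (u v w : Plane) :
    m.coeffDeriv i u v w (L.chart i x) =
      m.coeffDeriv j (L.coordChange i j x u) (L.coordChange i j x v) (L.coordChange i j x w)
        (L.chart j x) +
      m.coeff j (fderiv ℝ (fderiv ℝ (transition L i j x)) (L.chart i x).1 u v)
        (L.coordChange i j x w) (L.chart j x) +
      m.coeff j (L.coordChange i j x v)
        (fderiv ℝ (fderiv ℝ (transition L i j x)) (L.chart i x).1 u w) (L.chart j x) := by
  have hB₀ := hasFDerivAt_fderiv_transition hi hj
  generalize fderiv ℝ (fderiv ℝ (transition L i j x)) (L.chart i x).1 = B at hB₀ ⊢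
  set z₀ := (L.chart i x).1 with hz₀
  have hl0 : z₀ + (0 : ℝ) • u = z₀ := by simp
  have hline : HasDerivAt (fun s : ℝ => z₀ + s • u) u 0 := by
    simpa using ((hasDerivAt_id (0 : ℝ)).smul_const u).const_add z₀
  have h1 := m.hasDerivAt_coeff (i := i) (t := (L.chart i x).2) (s := 0) (z₀ := z₀) hl0 rfl rfl
    ((L.chart i).map_source hi) hline (hasDerivAt_const (0 : ℝ) v) (hasDerivAt_const (0 : ℝ) w)
  have hcc : L.coordChange i j x = fderiv ℝ (transition L i j x) z₀ :=
    coordChange_eq_fderiv_transition (rfl : (L.chart i x).2 = (L.chart i x).2)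
  have hD : HasFDerivAt (transition L i j x) (L.coordChange i j x) (z₀ + (0 : ℝ) • u) := by
    rw [hl0, hcc]
    exact ((contDiffAt_transition hi hj).differentiableAt (by simp)).hasFDerivAt
  have hB : HasFDerivAt (fderiv ℝ (transition L i j x)) B (z₀ + (0 : ℝ) • u) := by
    rw [hl0]
    exact hB₀
  have hv : ∀ a : Plane, HasDerivAt (fun s : ℝ => fderiv ℝ (transition L i j x) (z₀ + s • u) a)
      (B u a) 0 := fun a =>
    (ContinuousLinearMap.apply ℝ Plane a).hasFDerivAt.comp_hasDerivAt (0 : ℝ)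
      (hB.comp_hasDerivAt (0 : ℝ) hline)
  have hζ : transition L i j x z₀ = (L.chart j x).1 :=
    transition_chart hi (rfl : (L.chart i x).2 = (L.chart i x).2)
  have hd0 : ∀ a : Plane, fderiv ℝ (transition L i j x) (z₀ + (0 : ℝ) • u) a =
      L.coordChange i j x a := fun a => by rw [hl0, hcc]
  have hline' : HasDerivAt (fun s : ℝ => transition L i j x (z₀ + s • u)) (L.coordChange i j x u) 0 :=
    HasFDerivAt.comp_hasDerivAt (l := transition L i j x) (0 : ℝ) hD hline
  have h2 := m.hasDerivAt_coeff (i := j) (t := (L.chart j x).2) (s := 0)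
    (z := fun s => transition L i j x (z₀ + s • u))
    (v := fun s => fderiv ℝ (transition L i j x) (z₀ + s • u) v)
    (w := fun s => fderiv ℝ (transition L i j x) (z₀ + s • u) w)
    (z₀ := (L.chart j x).1) (by rw [hl0, hζ]) (hd0 v) (hd0 w) ((L.chart j).map_source hj)
    hline' (hv v) (hv w)
  have hc : Tendsto (fun s : ℝ => z₀ + s • u) (𝓝 0) (𝓝 z₀) :=
    (show Continuous fun s : ℝ => z₀ + s • u by fun_prop).tendsto' _ _ hl0
  have hev : ∀ᶠ s in 𝓝 (0 : ℝ), (z₀ + s • u, (L.chart i x).2) ∈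
      ((L.chart i).symm.trans (L.chart j)).source :=
    hc.eventually (L.eventually_overlap hi hj)
  have h3 := h2.congr_of_eventuallyEq (hev.mono fun s hs =>
    m.coeff_eq_coeff_transition ⟨hi, hj⟩ hs v w)
  have h4 := h1.unique h3
  have hzero : ∀ a p, m.coeff i 0 a p = 0 := fun a p => by
    simpa using m.coeff_smul_left i 0 0 a p
  rw [m.coeff_comm i v 0, hzero, hzero, add_zero, add_zero] at h4
  exact h4

/-- Of the second-derivative terms in `coeffDeriv_transition`, symmetry of the second derivative
cancels all but one; that term is the correction which the chain rule adds to an acceleration. -/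
lemma christoffel_transition {i j : L.ι} {x : X} (hi : x ∈ (L.chart i).source)
    (hj : x ∈ (L.chart j).source) (u w : Plane) :
    m.christoffel i u u w (L.chart i x) =
      m.christoffel j (L.coordChange i j x u) (L.coordChange i j x u) (L.coordChange i j x w)
        (L.chart j x) +
      m.coeff j (fderiv ℝ (fderiv ℝ (transition L i j x)) (L.chart i x).1 u u)
        (L.coordChange i j x w) (L.chart j x) := by
  have hsymm := ((contDiffAt_transition hi hj).isSymmSndFDerivAt
    (by simpa using (WithTop.coe_le_coe.2 le_top : ((2 : ℕ∞) : WithTop ℕ∞) ≤ ∞))) u w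
  unfold christoffel
  simp only [m.coeffDeriv_transition hi hj]
  rw [hsymm, m.coeff_comm j (L.coordChange i j x u)
    (fderiv ℝ (fderiv ℝ (transition L i j x)) (L.chart i x).1 w u)]
  ring

variable {m}

/-- It suffices to check the geodesic equation in one foliated chart. -/
lemma isGeodesicAt_of_chart {c : ℝ → m.UnitTangentBundle} {s₀ : ℝ} {i : L.ι}
    (hi : (c s₀).1.proj ∈ (L.chart i).source)
    (h : ∀ᶠ s in 𝓝 s₀,
      (c s).1.proj ∈ (L.chart i).source ∧
      (L.chart i (c s).1.proj).2 = (L.chart i (c s₀).1.proj).2 ∧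
      HasDerivAt (fun r => m.state i (c r))
        (m.geodesicField i (L.chart i (c s).1.proj).2 (m.state i (c s))) s) :
    m.IsGeodesicAt c s₀ := by
  intro j hj
  have hcont : ContinuousAt c s₀ := by
    have hs := h.self_of_nhds.2.2.continuousAt
    refine (m.tendsto_iff_of_mem hi).2 ⟨h.mono fun _ h => h.1, ?_, hs.snd⟩
    have h1 : ContinuousAt
        (fun r => ((L.chart i (c r).1.proj).1, (L.chart i (c s₀).1.proj).2)) s₀ :=
      hs.fst.prodMk continuousAt_const
    refine h1.tendsto.congr' (h.mono fun r hr => ?_)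
    exact Prod.ext rfl hr.2.1.symm
  have hjev : ∀ᶠ s in 𝓝 s₀, (c s).1.proj ∈ (L.chart j).source :=
    (m.continuous_proj.continuousAt.comp hcont).eventually ((L.chart j).open_source.mem_nhds hj)
  filter_upwards [(h.and hjev).eventually_nhds] with s hs
  obtain ⟨⟨h1, h2, h3⟩, h4⟩ := hs.self_of_nhds
  have ht : (L.chart j (c s).1.proj).2 = (L.chart j (c s₀).1.proj).2 :=
    L.transverse i j _ ⟨h1, h4⟩ _ ⟨hi, hj⟩ h2
  set x := (c s).1.proj with hx
  set z₀ := (L.chart i x).1 with hz₀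
  set u := L.vectorCoord i (c s).1 with hu
  have hz : HasDerivAt (fun r => (L.chart i (c r).1.proj).1) u s := h3.fst
  have hv : HasDerivAt (fun r => L.vectorCoord i (c r).1) (m.accel i (L.chart i x) u) s := h3.snd
  have hpl : ∀ᶠ r in 𝓝 s, (L.chart i (c r).1.proj).2 = (L.chart i x).2 :=
    hs.mono fun r hr => hr.1.2.1.trans h2.symm
  have hcc := coordChange_eq_fderiv_transition (j := j) (rfl : (L.chart i x).2 = (L.chart i x).2)
  have hvj : L.vectorCoord j (c s).1 = L.coordChange i j x u := L.vectorCoord_eq_coordChange h1 h4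
  have hD : HasFDerivAt (transition L i j x) (fderiv ℝ (transition L i j x) z₀) z₀ :=
    ((contDiffAt_transition h1 h4).differentiableAt (by simp)).hasFDerivAt
  -- The acceleration in chart `j` is found by differentiating the transformed velocity `Dζ(z) z'`
  -- once more, with `ζ` the transition map.
  refine ⟨h4, ht, ?_, fderiv ℝ (fderiv ℝ (transition L i j x)) z₀ u u +
    L.coordChange i j x (m.accel i (L.chart i x) u), ?_, ?_⟩
  · rw [hvj, hcc]
    refine (hD.comp_hasDerivAt s hz).congr_of_eventuallyEq ?_
    filter_upwards [hs, hpl] with r hr hr'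
    exact (transition_chart hr.1.1 hr').symm
  · have hB := (hasFDerivAt_fderiv_transition h1 h4).comp_hasDerivAt s hz
    have h5 := hB.clm_apply hv
    rw [hcc]
    refine h5.congr_of_eventuallyEq ?_
    filter_upwards [hs, hpl] with r hr hr'
    rw [Function.comp_apply, ← coordChange_eq_fderiv_transition hr']
    exact L.vectorCoord_eq_coordChange hr.1.1 hr.2
  · intro w
    -- The derivative of the transition map is onto, so only test vectors coming from chart `i` need
    -- be considered.
    obtain ⟨w', rfl⟩ : ∃ w', L.coordChange i j x w' = w := by
      refine ⟨L.coordChange j i x w, ?_⟩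
      have e := L.tangentCore.coordChange_comp j i j x ⟨⟨h4, h1⟩, h4⟩ w
      exact e.trans (L.tangentCore.coordChange_self j x h4 w)
    have e1 := m.coeff_accel ((L.chart i).map_source h1) u w'
    rw [m.christoffel_transition h1 h4, m.coeff_chart h1] at e1
    rw [hvj, coeff_add_left]
    have e2 : m.coeff j (L.coordChange i j x (m.accel i (L.chart i x) u))
        (L.coordChange i j x w') (L.chart j x) = m.inner x
        (L.vectorOfCoord i x (m.accel i (L.chart i x) u)) (L.vectorOfCoord i x w') := by
      rw [m.coeff_chart h4, L.vectorOfCoord_coordChange h1 h4, L.vectorOfCoord_coordChange h1 h4]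
    rw [e2]
    linarith

end SurfaceLamination.SmoothMetric

/-! ### Time shifts, reversal, uniqueness and gluing of geodesics. -/

namespace SurfaceLamination.SmoothMetric

variable {X : Type*} [TopologicalSpace X] {L : SurfaceLamination X} {m : L.SmoothMetric}

lemma IsGeodesicAt.congr {c c' : ℝ → m.UnitTangentBundle} {s : ℝ} (h : m.IsGeodesicAt c s)
    (hcc : c =ᶠ[𝓝 s] c') : m.IsGeodesicAt c' s := by
  obtain ⟨i, hi⟩ := L.cover (c s).1.proj
  refine isGeodesicAt_of_chart (i := i) (hcc.self_of_nhds ▸ hi) ?_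
  filter_upwards [h.eventually_state hi, hcc.eventually_nhds] with r hr hr'
  rw [← hcc.self_of_nhds, ← hr'.self_of_nhds]
  exact ⟨hr.1, hr.2.1, hr.2.2.congr_of_eventuallyEq (hr'.mono fun x hx => by
    dsimp only
    rw [hx])⟩

lemma IsGeodesicAt.comp_add {c : ℝ → m.UnitTangentBundle} {s a : ℝ}
    (h : m.IsGeodesicAt c (s + a)) : m.IsGeodesicAt (fun r => c (r + a)) s := by
  obtain ⟨i, hi⟩ := L.cover (c (s + a)).1.proj
  refine isGeodesicAt_of_chart (i := i) hi ?_
  have hc : ContinuousAt (fun r => r + a) s := by fun_prop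
  filter_upwards [hc.eventually (h.eventually_state hi)] with r hr
  exact ⟨hr.1, hr.2.1, hr.2.2.comp_add_const r a⟩

lemma inner_add_left (x : X) (v v' w : L.TangentPlane x) :
    m.inner x (v + v') w = m.inner x v w + m.inner x v' w := by
  rw [map_add]
  rfl

lemma inner_smul_left (x : X) (r : ℝ) (v w : L.TangentPlane x) :
    m.inner x (r • v) w = r * m.inner x v w := by
  rw [map_smul]
  rfl

lemma inner_smul_add_smul_self (x : X) (a b : ℝ) (v w : L.TangentPlane x) :
    m.inner x (a • v + b • w) (a • v + b • w) =
      a ^ 2 * m.inner x v v + 2 * (a * b) * m.inner x v w + b ^ 2 * m.inner x w w := by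
  rw [inner_add_left, inner_smul_left, inner_smul_left, m.symm x v (a • v + b • w),
    m.symm x w (a • v + b • w), inner_add_left, inner_smul_left, inner_smul_left, inner_add_left,
    inner_smul_left, inner_smul_left, m.symm x w v]
  ring

lemma inner_neg_neg (x : X) (v : L.TangentPlane x) : m.inner x (-v) (-v) = m.inner x v v := by
  have h := inner_smul_add_smul_self (m := m) x (-1) 0 v v
  simp only [neg_smul, one_smul, zero_smul, add_zero] at h
  rw [h]
  ring

/-- The opposite of a unit tangent vector. -/
def opp (y : m.UnitTangentBundle) : m.UnitTangentBundle :=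
  ⟨⟨y.1.proj, -y.1.2⟩, (inner_neg_neg y.1.proj y.1.2).trans y.2⟩

lemma vectorCoord_opp (i : L.ι) (y : m.UnitTangentBundle) :
    L.vectorCoord i (opp y).1 = -L.vectorCoord i y.1 :=
  L.vectorCoord_neg i y.1.proj y.1.2

lemma opp_opp (y : m.UnitTangentBundle) : opp (opp y) = y := by
  obtain ⟨⟨x, v⟩, h⟩ := y
  exact Subtype.ext (congrArg (fun v => (⟨x, v⟩ : L.TangentBundle)) (neg_neg v))

lemma IsGeodesicAt.opp {c : ℝ → m.UnitTangentBundle} {s : ℝ}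
    (h : m.IsGeodesicAt c (-s)) : m.IsGeodesicAt (fun r => opp (c (-r))) s := by
  intro i hi
  have hc : ContinuousAt (fun r : ℝ => -r) s := by fun_prop
  filter_upwards [hc.eventually (h i hi)] with r hr
  obtain ⟨h1, h2, h3, a, h4, h5⟩ := hr
  refine ⟨h1, h2, ?_, a, ?_, fun w => ?_⟩
  · rw [vectorCoord_opp]
    have := h3.scomp r (hasDerivAt_neg r)
    rwa [neg_one_smul] at this
  · simp only [vectorCoord_opp]
    have := (h4.scomp r (hasDerivAt_neg r)).neg
    rwa [neg_one_smul, neg_neg] at this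
  · have h6 := h5 w
    have ht := (L.chart i).map_source h1
    rw [m.christoffel_quadratic ht] at h6
    rw [vectorCoord_opp]
    change m.coeff i a w (L.chart i (c (-r)).1.proj) + m.christoffel i _ _ w
      (L.chart i (c (-r)).1.proj) = 0
    rw [m.christoffel_quadratic ht]
    simpa using h6

/-- Uniqueness is the degenerate case of continuous dependence: with equal initial vectors, `c'`
lies in every neighbourhood of `c` at the same time. The Hausdorff property gives equality, and
continuation covers the interval. -/
lemma eqOn_Icc_of_isGeodesicAt [T2Space X] {c c' : ℝ → m.UnitTangentBundle} {τ : ℝ}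
    (hc : ∀ s ∈ Icc 0 τ, m.IsGeodesicAt c s) (hc' : ∀ s ∈ Icc 0 τ, m.IsGeodesicAt c' s)
    (h0 : c 0 = c' 0) : EqOn c c' (Icc 0 τ) := by
  refine IsClosed.Icc_subset_of_forall_exists_gt (s := {s | c s = c' s}) ?_ h0 ?_
  · have h1 : ContinuousOn c (Icc 0 τ) := fun s hs => (hc s hs).continuousAt.continuousWithinAt
    have h2 : ContinuousOn c' (Icc 0 τ) := fun s hs => (hc' s hs).continuousAt.continuousWithinAt
    have := (h1.prodMk h2).preimage_isClosed_of_isClosed isClosed_Icc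
      (isClosed_diagonal (X := m.UnitTangentBundle))
    rwa [inter_comm] at this
  · rintro s ⟨hs, hsI⟩ y hy
    obtain ⟨U, hU, ε, hε, hdep⟩ := m.exists_nhds_geodesic_dependence (c s)
    have hpos : 0 < min ε (min (τ - s) (y - s)) :=
      lt_min hε (lt_min (by linarith [hsI.2]) (by linarith [show s < y from hy]))
    set σ := min ε (min (τ - s) (y - s))
    have hσ1 : σ ≤ τ - s := (min_le_right _ _).trans (min_le_left _ _)
    have hσ2 : σ ≤ y - s := (min_le_right _ _).trans (min_le_right _ _)
    have hmem : ∀ r ∈ Icc 0 σ, r + s ∈ Icc 0 τ := fun r hr =>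
      ⟨by linarith [hr.1, hsI.1], by linarith [hr.2]⟩
    have hg : ∀ r ∈ Icc 0 σ, m.IsGeodesicAt (fun r => c (r + s)) r := fun r hr =>
      (hc _ (hmem r hr)).comp_add
    have hg' : ∀ r ∈ Icc 0 σ, m.IsGeodesicAt (fun r => c' (r + s)) r := fun r hr =>
      (hc' _ (hmem r hr)).comp_add
    have hr : σ ∈ Icc 0 σ := ⟨hpos.le, le_rfl⟩
    have hU0 : (fun r => c (r + s)) 0 ∈ U := by simpa using mem_of_mem_nhds hU
    -- The dependence statement is evaluated at the centre of its neighbourhood filter, that is,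
    -- with no perturbation.
    have hW : ∀ W ∈ 𝓝 (c (σ + s)), c' (σ + s) ∈ W := fun W hW =>
      (hdep σ (min_le_left _ _) _ hU0 hg σ hr W hW).self_of_nhds hr _ hg' (by simpa using hs.symm)
    have hle : pure (c' (σ + s)) ≤ 𝓝 (c (σ + s)) := fun W h => hW W h
    refine ⟨σ + s, (pure_le_nhds_iff.1 hle).symm, by linarith, by linarith⟩

/-- Backward times are reduced to forward ones by reversing both geodesics. -/
lemma eq_of_isGeodesicAt [T2Space X] {c c' : ℝ → m.UnitTangentBundle} {a s : ℝ}
    (hc : ∀ r ∈ uIcc a s, m.IsGeodesicAt c r) (hc' : ∀ r ∈ uIcc a s, m.IsGeodesicAt c' r)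
    (h0 : c a = c' a) : c s = c' s := by
  rcases le_total a s with has | has
  · rw [uIcc_of_le has] at hc hc'
    have h := eqOn_Icc_of_isGeodesicAt (τ := s - a) (c := fun r => c (r + a))
      (c' := fun r => c' (r + a))
      (fun r hr => (hc _ ⟨by linarith [hr.1], by linarith [hr.2]⟩).comp_add)
      (fun r hr => (hc' _ ⟨by linarith [hr.1], by linarith [hr.2]⟩).comp_add) (by simpa using h0)
      (x := s - a) ⟨by linarith, le_rfl⟩
    simpa using h
  · rw [uIcc_of_ge has] at hc hc'
    have key : ∀ c : ℝ → m.UnitTangentBundle, (∀ r ∈ Icc s a, m.IsGeodesicAt c r) →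
        ∀ r ∈ Icc 0 (a - s), m.IsGeodesicAt (fun r => SmoothMetric.opp (c (-r + a))) r :=
      fun c hc r hr => IsGeodesicAt.opp (c := fun r => c (r + a))
        (hc _ ⟨by linarith [hr.2], by linarith [hr.1]⟩).comp_add
    have h := eqOn_Icc_of_isGeodesicAt (key c hc) (key c' hc') (by simp [h0])
      (x := a - s) ⟨by linarith, le_rfl⟩
    have h' := congrArg SmoothMetric.opp h
    simpa [opp_opp] using h'

lemma eq_of_isGeodesicAt_Ioo [T2Space X] {c c' : ℝ → m.UnitTangentBundle} {a b p s : ℝ}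
    (hc : ∀ r ∈ Ioo a b, m.IsGeodesicAt c r) (hc' : ∀ r ∈ Ioo a b, m.IsGeodesicAt c' r)
    (hp : p ∈ Ioo a b) (h0 : c p = c' p) (hs : s ∈ Ioo a b) : c s = c' s :=
  have hsub := ordConnected_Ioo.uIcc_subset hp hs
  eq_of_isGeodesicAt (fun r hr => hc r (hsub hr)) (fun r hr => hc' r (hsub hr)) h0

/-- Gluing two geodesics which pass through the same vector at the time `p`. -/
lemma exists_glue [T2Space X] {c c' : ℝ → m.UnitTangentBundle} {a a' b b' p : ℝ}
    (hc : ∀ r ∈ Ioo a b, m.IsGeodesicAt c r) (hc' : ∀ r ∈ Ioo a' b', m.IsGeodesicAt c' r)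
    (haa : a ≤ a') (hbb : b ≤ b') (hp : p ∈ Ioo a' b) (h0 : c p = c' p) :
    ∀ r ∈ Ioo a b', m.IsGeodesicAt (fun s => if s ≤ p then c s else c' s) r := by
  intro r hr
  rcases lt_trichotomy r p with h | h | h
  · refine (hc r ⟨hr.1, h.trans hp.2⟩).congr ?_
    filter_upwards [gt_mem_nhds h] with s hs
    rw [if_pos hs.le]
  · refine (hc r ⟨hr.1, h ▸ hp.2⟩).congr ?_
    filter_upwards [Ioo_mem_nhds (h ▸ hp.1 : a' < r) (h ▸ hp.2 : r < b)] with s hs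
    split_ifs
    · rfl
    · exact eq_of_isGeodesicAt_Ioo (a := a') (b := b)
        (fun r hr => hc r ⟨haa.trans_lt hr.1, hr.2⟩)
        (fun r hr => hc' r ⟨hr.1, hr.2.trans_le hbb⟩) hp h0 hs
  · refine (hc' r ⟨hp.1.trans h, hr.2⟩).congr ?_
    filter_upwards [lt_mem_nhds h] with s hs
    rw [if_neg (not_le.2 hs)]

end SurfaceLamination.SmoothMetric

/-! ### Local existence of geodesics. -/

/-- The Picard-Lindelöf theorem for an autonomous equation, with control of the solution. -/
lemma exists_solution_mem_closedBall {E : Type*} [NormedAddCommGroup E] [NormedSpace ℝ E]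
    [CompleteSpace E] {f : E → E} {x₀ : E} {a M K : NNReal} {ε : ℝ} (hε : 0 ≤ ε)
    (hb : ∀ x ∈ Metric.closedBall x₀ a, ‖f x‖ ≤ M)
    (hl : LipschitzOnWith K f (Metric.closedBall x₀ a)) (hM : M * ε ≤ a) :
    ∃ α : ℝ → E, α 0 = x₀ ∧ ∀ s ∈ Ioo (-ε) ε, α s ∈ Metric.closedBall x₀ a ∧
      HasDerivAt α (f (α s)) s := by
  have h0 : (0 : ℝ) ∈ Icc (-ε) ε := ⟨by linarith, hε⟩
  have hf : IsPicardLindelof (fun _ => f) (⟨0, h0⟩ : Icc (-ε) ε) x₀ a 0 M K :=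
    IsPicardLindelof.of_time_independent hb hl (by simpa using hM)
  have hx : x₀ ∈ Metric.closedBall x₀ ((0 : NNReal) : ℝ) := by simp
  -- The fixed point of the Picard iteration is used directly because elements of its function space
  -- come with confinement to the ball.
  obtain ⟨α, hα⟩ := ODE.FunSpace.exists_isFixedPt_next hf hx
  have hmem : ∀ t, α.compProj t ∈ Metric.closedBall x₀ a := fun t =>
    α.compProj_mem_closedBall hf.mul_max_le
  have heq : ∀ t ∈ Icc (-ε) ε, α.compProj t = ODE.picard (fun _ => f) 0 x₀ α.compProj t := by
    intro t ht
    conv_lhs => rw [← hα]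
    rw [ODE.FunSpace.compProj_apply, ODE.FunSpace.next_apply, projIcc_of_mem _ ht]
  refine ⟨α.compProj, by rw [heq 0 h0]; simp, fun s hs => ⟨hmem s, ?_⟩⟩
  have hd := ODE.hasDerivWithinAt_picard_Icc h0 (f := fun _ => f) (u := Metric.closedBall x₀ a)
    (α := α.compProj) (hl.continuousOn.comp continuousOn_snd fun q hq => hq.2)
    α.continuous_compProj.continuousOn (fun t _ => hmem t) x₀ (Ioo_subset_Icc_self hs)
  exact ((hd.congr heq (heq s (Ioo_subset_Icc_self hs))).hasDerivAt (Icc_mem_nhds hs.1 hs.2))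

namespace SurfaceLamination.SmoothMetric

variable {X : Type*} [TopologicalSpace X] {L : SurfaceLamination X} (m : L.SmoothMetric)

/-- Conservation of speed: the derivative of the squared length is `2 (⟨a, u⟩ + Γ(u, u; u))`, where
`a` is the acceleration, and this vanishes by the geodesic equation. It ensures that coordinate
solutions starting at unit vectors stay in `T¹L`. -/
lemma coeff_eq_of_solution {i : L.ι} {t : L.T i} {α : ℝ → Plane × Plane} {ε : ℝ}
    (ht : ∀ s ∈ Ioo (-ε) ε, ((α s).1, t) ∈ (L.chart i).target)
    (hα : ∀ s ∈ Ioo (-ε) ε, HasDerivAt α (m.geodesicField i t (α s)) s) {s : ℝ}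
    (hs : s ∈ Ioo (-ε) ε) :
    m.coeff i (α s).2 (α s).2 ((α s).1, t) = m.coeff i (α 0).2 (α 0).2 ((α 0).1, t) := by
  have hd : ∀ s ∈ Ioo (-ε) ε,
      HasDerivAt (fun s => m.coeff i (α s).2 (α s).2 ((α s).1, t)) 0 s := by
    intro s hs
    have h := m.hasDerivAt_coeff rfl rfl rfl (ht s hs) (hα s hs).fst (hα s hs).snd (hα s hs).snd
    refine h.congr_deriv ?_
    have e := m.coeff_accel (ht s hs) (α s).2 (α s).2
    rw [m.christoffel_self_self] at e
    change m.coeffDeriv i (α s).2 (α s).2 (α s).2 ((α s).1, t) +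
      m.coeff i (m.accel i ((α s).1, t) (α s).2) (α s).2 ((α s).1, t) +
      m.coeff i (α s).2 (m.accel i ((α s).1, t) (α s).2) ((α s).1, t) = 0
    rw [m.coeff_comm i (α s).2 (m.accel i ((α s).1, t) (α s).2)]
    linarith
  have h0 : (0 : ℝ) ∈ Ioo (-ε) ε := ⟨by linarith [hs.1, hs.2], by linarith [hs.1, hs.2]⟩
  exact isOpen_Ioo.is_const_of_deriv_eq_zero isPreconnected_Ioo
    (fun s hs => (hd s hs).differentiableAt.differentiableWithinAt)
    (fun s hs => (hd s hs).deriv) hs h0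

lemma exists_isGeodesicAt_of_solution {i : L.ι} {t : L.T i} {α : ℝ → Plane × Plane} {ε : ℝ}
    (hε : 0 < ε) (ht : ∀ s ∈ Ioo (-ε) ε, ((α s).1, t) ∈ (L.chart i).target)
    (hα : ∀ s ∈ Ioo (-ε) ε, HasDerivAt α (m.geodesicField i t (α s)) s) {w : m.UnitTangentBundle}
    (hw : w.1.proj ∈ (L.chart i).source) (hwt : (L.chart i w.1.proj).2 = t)
    (hw0 : α 0 = m.state i w) :
    ∃ c : ℝ → m.UnitTangentBundle, c 0 = w ∧ ∀ s ∈ Ioo (-ε) ε, m.IsGeodesicAt c s := by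
  have hunit : ∀ s ∈ Ioo (-ε) ε, m.coeff i (α s).2 (α s).2 ((α s).1, t) = 1 := by
    intro s hs
    rw [m.coeff_eq_of_solution ht hα hs, hw0, ← hwt]
    exact m.coeff_vectorCoord_self w hw
  have h0 : (0 : ℝ) ∈ Ioo (-ε) ε := ⟨by linarith, hε⟩
  classical
  -- The default value `w` is never taken on `(-ε, ε)`, where the speed is one.
  set c : ℝ → m.UnitTangentBundle := fun s =>
    if h : m.coeff i (α s).2 (α s).2 ((α s).1, t) = 1 then m.ofCoord i ((α s).1, t) (α s).2 h
    else w with hcdef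
  have hc : ∀ s ∈ Ioo (-ε) ε, (c s).1.proj ∈ (L.chart i).source ∧
      (L.chart i (c s).1.proj).2 = t ∧ m.state i (c s) = α s := by
    intro s hs
    have e : c s = m.ofCoord i ((α s).1, t) (α s).2 (hunit s hs) := dif_pos (hunit s hs)
    have h1 := m.chart_ofCoord (ht s hs) (hunit s hs)
    refine ⟨e ▸ m.proj_ofCoord_mem (ht s hs) _, ?_, ?_⟩
    · rw [e, h1]
    · rw [e, state, h1, m.vectorCoord_ofCoord (ht s hs)]
  refine ⟨c, ?_, fun s hs => isGeodesicAt_of_chart (i := i) (hc s hs).1 ?_⟩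
  · obtain ⟨h1, h2, h3⟩ := hc 0 h0
    rw [hw0] at h3
    exact m.ext_coord h1 hw (Prod.ext (Prod.ext_iff.1 h3).1 (h2.trans hwt.symm))
      (Prod.ext_iff.1 h3).2
  · filter_upwards [Ioo_mem_nhds hs.1 hs.2] with r hr
    obtain ⟨h1, h2, h3⟩ := hc r hr
    refine ⟨h1, h2.trans (hc s hs).2.1.symm, ?_⟩
    rw [h2, h3]
    refine (hα r hr).congr_of_eventuallyEq ?_
    filter_upwards [Ioo_mem_nhds hr.1 hr.2] with q hq using (hc q hq).2.2

/-- Geodesics exist locally, for a time which is locally bounded from below. -/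
lemma exists_nhds_isGeodesicAt (v : m.UnitTangentBundle) :
    ∃ ε > 0, ∀ᶠ w in 𝓝 v, ∃ c : ℝ → m.UnitTangentBundle, c 0 = w ∧
      ∀ s ∈ Ioo (-ε) ε, m.IsGeodesicAt c s := by
  obtain ⟨i, hi⟩ := L.cover v.1.proj
  obtain ⟨r, C, T₀, hT₀, hB⟩ := m.exists_isPlaqueBox (z₀ := (L.chart i v.1.proj).1)
    (t₀ := (L.chart i v.1.proj).2) ((L.chart i).map_source hi)
  have ht₀ := mem_of_mem_nhds hT₀
  set t₀ := (L.chart i v.1.proj).2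
  set z₀ := (L.chart i v.1.proj).1
  have hr := hB.radius_pos
  set Q := Metric.closedBall z₀ (2 * r) ×ˢ Metric.closedBall (0 : Plane) (C + 1)
  obtain ⟨K₀, hK₀⟩ := hB.exists_lipschitzOnWith ht₀ (C + 1)
  obtain ⟨M, hM⟩ := ((isCompact_closedBall z₀ (2 * r)).prod
    (isCompact_closedBall (0 : Plane) (C + 1))).exists_bound_of_continuousOn hK₀.continuousOn
  have hMpos : 0 < |M| + 1 := by positivity
  have hev := hB.eventually_dist_geodesicField_lt ht₀ (C + 1) one_pos
  -- Radius `r` keeps positions within `2 r` of the centre and radius `1` keeps velocities below `C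
  -- + 1`. On nearby plaques the field differs by less than `1` from the central one, hence the
  -- bound `|M| + 1` and the common existence time `a / (|M| + 1)`.
  set a := min r 1
  have ha : 0 < a := lt_min hr one_pos
  refine ⟨a / (|M| + 1), by positivity, ?_⟩
  filter_upwards [m.continuous_proj.continuousAt.eventually ((L.chart i).open_source.mem_nhds hi),
    (m.continuousAt_coord hi).1.fst.eventually (Metric.ball_mem_nhds z₀ hr),
    (m.continuousAt_coord hi).1.snd.eventually hT₀, (m.continuousAt_coord hi).1.snd.eventually hev]
    with w h1 h2 h3 h4
  have h2' : dist (L.chart i w.1.proj).1 z₀ < r := h2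
  have hw2 : ‖L.vectorCoord i w.1‖ < C :=
    hB.norm_vectorCoord_lt h1 (Metric.mem_closedBall.2 (by linarith)) h3
  have hsub : Metric.closedBall (m.state i w) a ⊆ Q := by
    rintro ⟨z, u⟩ hzu
    rw [Metric.mem_closedBall, Prod.dist_eq, max_le_iff] at hzu
    obtain ⟨k1, k2⟩ := hzu
    constructor
    · have := dist_triangle z (L.chart i w.1.proj).1 z₀
      have k1' : dist z (L.chart i w.1.proj).1 ≤ a := k1
      rw [Metric.mem_closedBall]
      linarith [min_le_left r 1]
    · have k2' : dist u (L.vectorCoord i w.1) ≤ a := k2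
      have := norm_le_norm_add_norm_sub' u (L.vectorCoord i w.1)
      rw [mem_closedBall_zero_iff]
      rw [dist_eq_norm] at k2'
      linarith [min_le_right r 1]
  obtain ⟨K, hK⟩ := hB.exists_lipschitzOnWith h3 (C + 1)
  have hnorm : ∀ x ∈ Q, ‖m.geodesicField i (L.chart i w.1.proj).2 x‖ ≤ |M| + 1 := by
    intro x hx
    have k := h4 x hx
    have k' := hM x hx
    rw [dist_eq_norm] at k
    have := norm_le_norm_add_norm_sub' (m.geodesicField i (L.chart i w.1.proj).2 x)
      (m.geodesicField i t₀ x)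
    linarith [le_abs_self M]
  obtain ⟨α, hα0, hα⟩ := exists_solution_mem_closedBall (f := m.geodesicField i (L.chart i w.1.proj).2)
    (x₀ := m.state i w) (a := ⟨a, ha.le⟩) (M := ⟨|M| + 1, hMpos.le⟩) (K := K)
    (ε := a / (|M| + 1)) (by positivity) (fun x hx => hnorm x (hsub hx)) (hK.mono hsub)
    (by change (|M| + 1) * (a / (|M| + 1)) ≤ a; field_simp; rfl)
  exact m.exists_isGeodesicAt_of_solution (by positivity)
    (fun s hs => hB.mem_target _ (hsub (hα s hs).1).1 _ h3) (fun s hs => (hα s hs).2) h1 rfl hα0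

end SurfaceLamination.SmoothMetric

/-! ### Compactness of the unit tangent bundle and completeness of geodesics. -/

namespace SurfaceLamination.SmoothMetric

variable {X : Type*} [TopologicalSpace X] {L : SurfaceLamination X} (m : L.SmoothMetric)

lemma exists_isCompact_nhds_plaqueBox [T2Space X] [CompactSpace X] (x : X) :
    ∃ i : L.ι, ∃ B ∈ 𝓝 x, IsCompact B ∧ B ⊆ (L.chart i).source ∧
      ∃ C, ∀ y : m.UnitTangentBundle, y.1.proj ∈ B → ‖L.vectorCoord i y.1‖ ≤ C := by
  obtain ⟨i, hi⟩ := L.cover x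
  obtain ⟨r, C, T₀, hT₀, hB⟩ := m.exists_isPlaqueBox (z₀ := (L.chart i x).1)
    (t₀ := (L.chart i x).2) ((L.chart i).map_source hi)
  have hc : ContinuousAt (L.chart i) x := (L.chart i).continuousAt hi
  have hV : {y | y ∈ (L.chart i).source ∧
      (L.chart i y).1 ∈ Metric.closedBall (L.chart i x).1 (2 * r) ∧ (L.chart i y).2 ∈ T₀} ∈ 𝓝 x := by
    filter_upwards [(L.chart i).open_source.mem_nhds hi, hc.fst.eventually
      (Metric.closedBall_mem_nhds _ (mul_pos two_pos hB.radius_pos)), hc.snd.eventually hT₀]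
      with y h1 h2 h3 using ⟨h1, h2, h3⟩
  obtain ⟨B, hBx, hBV, hBc⟩ := local_compact_nhds hV
  refine ⟨i, B, hBx, hBc, fun y hy => (hBV hy).1, C, fun y hy => ?_⟩
  obtain ⟨h1, h2, h3⟩ := hBV hy
  exact (hB.norm_vectorCoord_lt h1 h2 h3).le

/-- Over a small compact piece of the base, unit vectors have bounded coordinates. An ultrafilter
then has a limit in base point and coordinates, and the limit vector is a unit vector by continuity
of the metric. Finitely many pieces cover `X`. -/
instance [T2Space X] [CompactSpace X] : CompactSpace m.UnitTangentBundle := by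
  suffices h : ∃ Q : Set m.UnitTangentBundle, IsCompact Q ∧ ∀ y : m.UnitTangentBundle,
      y.1.proj ∈ (univ : Set X) → y ∈ Q by
    obtain ⟨Q, hQ, h⟩ := h
    exact ⟨hQ.of_isClosed_subset isClosed_univ fun y _ => h y trivial⟩
  refine isCompact_univ.induction_on (p := fun S : Set X => ∃ Q : Set m.UnitTangentBundle,
    IsCompact Q ∧ ∀ y : m.UnitTangentBundle, y.1.proj ∈ S → y ∈ Q) ?_ ?_ ?_ ?_
  · exact ⟨∅, isCompact_empty, fun y hy => hy⟩
  · rintro S S' hS ⟨Q, hQ, h⟩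
    exact ⟨Q, hQ, fun y hy => h y (hS hy)⟩
  · rintro S S' ⟨Q, hQ, h⟩ ⟨Q', hQ', h'⟩
    exact ⟨Q ∪ Q', hQ.union hQ', fun y hy => hy.imp (h y) (h' y)⟩
  · intro x _
    obtain ⟨i, B, hBx, hBc, hBi, C, hC⟩ := m.exists_isCompact_nhds_plaqueBox x
    refine ⟨B, mem_nhdsWithin_of_mem_nhds hBx, {y | y.1.proj ∈ B}, ?_, fun y hy => hy⟩
    rw [isCompact_iff_ultrafilter_le_nhds]
    intro f hf
    have hfB : ∀ᶠ y in (f : Filter m.UnitTangentBundle), y.1.proj ∈ B := le_principal_iff.1 hf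
    obtain ⟨x', hx', hfx⟩ := isCompact_iff_ultrafilter_le_nhds.1 hBc
      (f.map fun y : m.UnitTangentBundle => y.1.proj)
      (tendsto_principal.2 hfB : Tendsto (fun y : m.UnitTangentBundle => y.1.proj) f (𝓟 B))
    obtain ⟨u, -, hfu⟩ := isCompact_iff_ultrafilter_le_nhds.1
      (isCompact_closedBall (0 : Plane) C) (f.map fun y : m.UnitTangentBundle => L.vectorCoord i y.1)
      (tendsto_principal.2 (hfB.mono fun y hy => mem_closedBall_zero_iff.2 (hC y hy)) :
        Tendsto (fun y : m.UnitTangentBundle => L.vectorCoord i y.1) f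
          (𝓟 (Metric.closedBall (0 : Plane) C)))
    have hx'i := hBi hx'
    have hp : Tendsto (fun y : m.UnitTangentBundle => L.chart i y.1.proj) f (𝓝 (L.chart i x')) :=
      ((L.chart i).continuousAt hx'i).tendsto.comp hfx
    have hu : Tendsto (fun y : m.UnitTangentBundle => L.vectorCoord i y.1) f (𝓝 u) := hfu
    have ht := (L.chart i).map_source hx'i
    have hunit : m.coeff i u u (L.chart i x') = 1 := by
      have h1 := ((m.continuousAt_coeff (i := i)
        (f := fun q : (Plane × L.T i) × Plane => q.2) (g := fun q : (Plane × L.T i) × Plane => q.2)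
        (q := fun q : (Plane × L.T i) × Plane => q.1) (a := (L.chart i x', u)) continuousAt_fst
        continuousAt_snd continuousAt_snd ht).tendsto).comp (hp.prodMk_nhds hu)
      refine tendsto_nhds_unique h1 (tendsto_const_nhds.congr' ?_)
      filter_upwards [hfB] with y hy
      exact (m.coeff_vectorCoord_self y (hBi hy)).symm
    have hmem := m.proj_ofCoord_mem ht hunit
    refine ⟨m.ofCoord i (L.chart i x') u hunit, ?_, ?_⟩
    · change (L.chart i).symm (L.chart i x') ∈ B
      rwa [(L.chart i).left_inv hx'i]
    · refine (m.tendsto_iff_of_mem (f := id) hmem).2 ⟨hfB.mono fun y hy => hBi hy, ?_, ?_⟩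
      · rw [m.chart_ofCoord ht hunit]
        exact hp
      · rw [m.vectorCoord_ofCoord ht hunit]
        exact hu

lemma exists_uniform_isGeodesicAt [T2Space X] [CompactSpace X] :
    ∃ ε > 0, ∀ w : m.UnitTangentBundle, ∃ c : ℝ → m.UnitTangentBundle, c 0 = w ∧
      ∀ s ∈ Ioo (-ε) ε, m.IsGeodesicAt c s := by
  suffices h : ∃ ε > 0, ∀ w ∈ (univ : Set m.UnitTangentBundle), ∃ c : ℝ → m.UnitTangentBundle,
      c 0 = w ∧ ∀ s ∈ Ioo (-ε) ε, m.IsGeodesicAt c s by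
    obtain ⟨ε, hε, h⟩ := h
    exact ⟨ε, hε, fun w => h w trivial⟩
  refine isCompact_univ.induction_on (p := fun S : Set m.UnitTangentBundle => ∃ ε > 0, ∀ w ∈ S,
    ∃ c : ℝ → m.UnitTangentBundle, c 0 = w ∧ ∀ s ∈ Ioo (-ε) ε, m.IsGeodesicAt c s) ?_ ?_ ?_ ?_
  · exact ⟨1, one_pos, fun w hw => hw.elim⟩
  · rintro S S' hS ⟨ε, hε, h⟩
    exact ⟨ε, hε, fun w hw => h w (hS hw)⟩
  · rintro S S' ⟨ε, hε, h⟩ ⟨ε', hε', h'⟩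
    refine ⟨min ε ε', lt_min hε hε', fun w hw => ?_⟩
    rcases hw with hw | hw
    · obtain ⟨c, h0, hc⟩ := h w hw
      exact ⟨c, h0, fun s hs => hc s ⟨by linarith [hs.1, min_le_left ε ε'],
        hs.2.trans_le (min_le_left _ _)⟩⟩
    · obtain ⟨c, h0, hc⟩ := h' w hw
      exact ⟨c, h0, fun s hs => hc s ⟨by linarith [hs.1, min_le_right ε ε'],
        hs.2.trans_le (min_le_right _ _)⟩⟩
  · intro v _
    obtain ⟨ε, hε, h⟩ := m.exists_nhds_isGeodesicAt v
    exact ⟨_, mem_nhdsWithin_of_mem_nhds h, ε, hε, fun w hw => hw⟩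

/-- Restarting at the times `T / 2` and `-T / 2` gains `T / 2` at each end, hence the factor `3 /
2`. -/
lemma exists_isGeodesicAt_extend [T2Space X] {T : ℝ} (hT : 0 < T)
    (h : ∀ w : m.UnitTangentBundle, ∃ c : ℝ → m.UnitTangentBundle, c 0 = w ∧
      ∀ s ∈ Ioo (-T) T, m.IsGeodesicAt c s) (w : m.UnitTangentBundle) :
    ∃ c : ℝ → m.UnitTangentBundle, c 0 = w ∧
      ∀ s ∈ Ioo (-(3 / 2 * T)) (3 / 2 * T), m.IsGeodesicAt c s := by
  obtain ⟨c, hc0, hc⟩ := h w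
  obtain ⟨a, ha0, ha⟩ := h (c (T / 2))
  obtain ⟨b, hb0, hb⟩ := h (c (-(T / 2)))
  have ha' : ∀ s ∈ Ioo (-(T / 2)) (3 / 2 * T), m.IsGeodesicAt (fun s => a (s + -(T / 2))) s :=
    fun s hs => (ha _ ⟨by linarith [hs.1], by linarith [hs.2]⟩).comp_add
  have hb' : ∀ s ∈ Ioo (-(3 / 2 * T)) (T / 2), m.IsGeodesicAt (fun s => b (s + T / 2)) s :=
    fun s hs => (hb _ ⟨by linarith [hs.1], by linarith [hs.2]⟩).comp_add
  have h1 := exists_glue hc ha' (by linarith) (by linarith) (p := T / 2)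
    ⟨by linarith, by linarith⟩ (by simp [ha0])
  have h2 := exists_glue hb' h1 (by linarith) (by linarith) (p := -(T / 2))
    ⟨by linarith, by linarith⟩ (by
      rw [if_pos (by linarith), neg_add_cancel, hb0])
  refine ⟨_, ?_, h2⟩
  rw [if_neg (by linarith), if_pos (by linarith), hc0]

/-- Geodesics of a compact lamination are defined for all times. -/
theorem exists_isGeodesic [T2Space X] [CompactSpace X] (v : m.UnitTangentBundle) :
    ∃ c : ℝ → m.UnitTangentBundle, m.IsGeodesic c ∧ c 0 = v := by
  obtain ⟨ε, hε, h⟩ := m.exists_uniform_isGeodesicAt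
  have hall : ∀ n : ℕ, ∀ w : m.UnitTangentBundle, ∃ c : ℝ → m.UnitTangentBundle, c 0 = w ∧
      ∀ s ∈ Ioo (-((3 / 2) ^ n * ε)) ((3 / 2) ^ n * ε), m.IsGeodesicAt c s := by
    intro n
    induction n with
    | zero => simpa using h
    | succ n ih =>
      intro w
      have := m.exists_isGeodesicAt_extend (by positivity) ih w
      rwa [← mul_assoc, ← pow_succ'] at this
  choose c hc0 hc using fun n => hall n v
  have hlim : Tendsto (fun n : ℕ => (3 / 2 : ℝ) ^ n * ε) atTop atTop :=
    (tendsto_pow_atTop_atTop_of_one_lt (by norm_num)).atTop_mul_const hε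
  choose N hN using fun s : ℝ => (hlim.eventually_gt_atTop |s|).exists
  have hpos : ∀ n : ℕ, 0 < (3 / 2 : ℝ) ^ n * ε := fun n => by positivity
  have hagree : ∀ k n : ℕ, ∀ s : ℝ, |s| < (3 / 2) ^ k * ε → |s| < (3 / 2) ^ n * ε →
      c k s = c n s := by
    intro k n s hk hn
    have hm := lt_min hk hn
    have h0 := lt_min (hpos k) (hpos n)
    refine eq_of_isGeodesicAt_Ioo (a := -min ((3 / 2 : ℝ) ^ k * ε) ((3 / 2) ^ n * ε))
      (b := min ((3 / 2 : ℝ) ^ k * ε) ((3 / 2) ^ n * ε)) (p := 0) (fun r hr => hc k r ?_)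
      (fun r hr => hc n r ?_) ⟨by linarith, h0⟩ ((hc0 k).trans (hc0 n).symm) (abs_lt.1 hm)
    · exact ⟨by linarith [hr.1, min_le_left ((3 / 2 : ℝ) ^ k * ε) ((3 / 2) ^ n * ε)],
        hr.2.trans_le (min_le_left _ _)⟩
    · exact ⟨by linarith [hr.1, min_le_right ((3 / 2 : ℝ) ^ k * ε) ((3 / 2) ^ n * ε)],
        hr.2.trans_le (min_le_right _ _)⟩
  -- The time `s` is served by any geodesic of the sequence defined beyond `|s|`; by `hagree` the
  -- choice is immaterial, so near each time this coincides with one fixed geodesic.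
  refine ⟨fun s => c (N s) s, m.isGeodesic_iff.2 fun s => ?_, hc0 _⟩
  refine (hc (N s) s (abs_lt.1 (hN s))).congr ?_
  filter_upwards [continuous_abs.continuousAt.eventually (gt_mem_nhds (hN s))] with r hr
  exact hagree _ _ r hr (hN r)

lemma continuous_opp : Continuous (opp : m.UnitTangentBundle → m.UnitTangentBundle) := by
  rw [continuous_iff_continuousAt]
  intro y
  obtain ⟨i, hi⟩ := L.cover y.1.proj
  obtain ⟨h1, h2, h3⟩ := (m.tendsto_iff_of_mem hi).1 (tendsto_id (x := 𝓝 y))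
  refine (m.tendsto_iff_of_mem (y := opp y) (i := i) hi).2 ⟨h1, h2, ?_⟩
  simp only [vectorCoord_opp]
  exact h3.neg

/-! ### The flow property, reversibility and continuity of the geodesic flow. -/

section Flow

variable [T2Space X] [CompactSpace X]

lemma isGeodesic_geodesicFlow (v : m.UnitTangentBundle) :
    m.IsGeodesic (fun t => m.geodesicFlow t v) := by
  unfold geodesicFlow
  simp only [dif_pos (m.exists_isGeodesic v)]
  exact (m.exists_isGeodesic v).choose_spec.1

lemma geodesicFlow_zero (v : m.UnitTangentBundle) : m.geodesicFlow 0 v = v := by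
  unfold geodesicFlow
  rw [dif_pos (m.exists_isGeodesic v)]
  exact (m.exists_isGeodesic v).choose_spec.2

/-- By uniqueness the geodesic chosen in the definition is the only one. The group law and
reversibility follow by applying this to shifted and reversed orbits. -/
lemma geodesicFlow_eq {c : ℝ → m.UnitTangentBundle} (hc : m.IsGeodesic c) (t : ℝ) :
    m.geodesicFlow t (c 0) = c t :=
  eq_of_isGeodesicAt (c := fun t => m.geodesicFlow t (c 0)) (a := 0)
    (fun r _ => m.isGeodesic_geodesicFlow _ r) (fun r _ => hc r) (m.geodesicFlow_zero _)

lemma geodesicFlow_add (t s : ℝ) (v : m.UnitTangentBundle) :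
    m.geodesicFlow (t + s) v = m.geodesicFlow t (m.geodesicFlow s v) := by
  have h : m.IsGeodesic (fun r => m.geodesicFlow (r + s) v) := fun r =>
    IsGeodesicAt.comp_add (c := fun r => m.geodesicFlow r v) (m.isGeodesic_geodesicFlow v (r + s))
  have := m.geodesicFlow_eq h t
  simpa using this.symm

lemma geodesicFlow_opp (t : ℝ) (v : m.UnitTangentBundle) :
    m.geodesicFlow t (opp v) = opp (m.geodesicFlow (-t) v) := by
  have h : m.IsGeodesic (fun r => opp (m.geodesicFlow (-r) v)) := fun r =>
    IsGeodesicAt.opp (c := fun r => m.geodesicFlow r v) (m.isGeodesic_geodesicFlow v (-r))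
  have := m.geodesicFlow_eq h t
  simpa [m.geodesicFlow_zero] using this

/-- Local dependence covers nonnegative times; negative times follow by conjugating with `opp`. -/
lemma continuousAt_geodesicFlow_zero (v : m.UnitTangentBundle) :
    ContinuousAt (fun q : ℝ × m.UnitTangentBundle => m.geodesicFlow q.1 q.2) (0, v) := by
  have key : ∀ v : m.UnitTangentBundle, ∀ W ∈ 𝓝 v, ∀ᶠ q : ℝ × m.UnitTangentBundle in 𝓝 (0, v),
      0 ≤ q.1 → m.geodesicFlow q.1 q.2 ∈ W := by
    intro v W hW
    obtain ⟨U, hU, ε, hε, h⟩ := m.exists_nhds_geodesic_dependence v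
    have h' := h ε le_rfl (fun t => m.geodesicFlow t v)
      (by simpa [m.geodesicFlow_zero] using mem_of_mem_nhds hU)
      (fun s _ => m.isGeodesic_geodesicFlow v s) 0 ⟨le_rfl, hε.le⟩ W
      (by simpa [m.geodesicFlow_zero] using hW)
    rw [m.geodesicFlow_zero] at h'
    filter_upwards [h', continuousAt_fst.eventually (gt_mem_nhds hε)] with q hq hqε hq0
    exact hq ⟨hq0, le_of_lt hqε⟩ (fun t => m.geodesicFlow t q.2)
      (fun s _ => m.isGeodesic_geodesicFlow _ s) (m.geodesicFlow_zero _)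
  intro W hW
  change W ∈ 𝓝 (m.geodesicFlow 0 v) at hW
  rw [m.geodesicFlow_zero] at hW
  have hopp : Tendsto (fun q : ℝ × m.UnitTangentBundle => (-q.1, opp q.2)) (𝓝 (0, v))
      (𝓝 (0, opp v)) := by
    have hc : Continuous fun q : ℝ × m.UnitTangentBundle => (-q.1, opp q.2) :=
      continuous_fst.neg.prodMk (m.continuous_opp.comp continuous_snd)
    exact hc.tendsto' _ _ (by simp)
  have hW' : opp ⁻¹' W ∈ 𝓝 (opp v) := m.continuous_opp.continuousAt (by rwa [opp_opp])
  refine mem_map.2 ?_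
  filter_upwards [key v W hW, hopp.eventually (key (opp v) _ hW')] with q h1 h2
  rcases le_total 0 q.1 with h | h
  · exact h1 h
  · have h3 : opp (m.geodesicFlow (-q.1) (opp q.2)) ∈ W := h2 (by simpa using h)
    rw [m.geodesicFlow_opp, opp_opp, neg_neg] at h3
    exact h3

lemma exists_uniform_continuous_geodesicFlow :
    ∃ ε > 0, ∀ s ∈ Icc 0 ε, Continuous (m.geodesicFlow s) := by
  suffices h : ∃ ε > 0, ∀ s ∈ Icc 0 ε, ∀ v ∈ (univ : Set m.UnitTangentBundle),
      ContinuousAt (m.geodesicFlow s) v by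
    obtain ⟨ε, hε, h⟩ := h
    exact ⟨ε, hε, fun s hs => continuous_iff_continuousAt.2 fun v => h s hs v trivial⟩
  refine isCompact_univ.induction_on (p := fun S : Set m.UnitTangentBundle => ∃ ε > 0,
    ∀ s ∈ Icc 0 ε, ∀ v ∈ S, ContinuousAt (m.geodesicFlow s) v) ?_ ?_ ?_ ?_
  · exact ⟨1, one_pos, fun s _ v hv => hv.elim⟩
  · rintro S S' hS ⟨ε, hε, h⟩
    exact ⟨ε, hε, fun s hs v hv => h s hs v (hS hv)⟩
  · rintro S S' ⟨ε, hε, h⟩ ⟨ε', hε', h'⟩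
    exact ⟨min ε ε', lt_min hε hε', fun s hs v hv => hv.elim
      (h s ⟨hs.1, hs.2.trans (min_le_left _ _)⟩ v) (h' s ⟨hs.1, hs.2.trans (min_le_right _ _)⟩ v)⟩
  · intro v _
    obtain ⟨U, hU, ε, hε, h⟩ := m.exists_nhds_geodesic_dependence v
    refine ⟨U, mem_nhdsWithin_of_mem_nhds hU, ε, hε, fun s hs w hw W hW => ?_⟩
    have h' := h ε le_rfl (fun t => m.geodesicFlow t w) (by simpa [m.geodesicFlow_zero] using hw)
      (fun s _ => m.isGeodesic_geodesicFlow w s) s hs W hW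
    rw [m.geodesicFlow_zero, nhds_prod_eq] at h'
    refine mem_map.2 ?_
    filter_upwards [h'.curry.self_of_nhds] with w' hw'
    exact hw' hs (fun t => m.geodesicFlow t w') (fun s _ => m.isGeodesic_geodesicFlow _ s)
      (m.geodesicFlow_zero _)

/-- A positive time is cut into equal steps within the uniform short time, so the map is an iterate
of a continuous one. Reversal handles negative times. -/
lemma continuous_geodesicFlow_apply (s : ℝ) : Continuous (m.geodesicFlow s) := by
  obtain ⟨ε, hε, h⟩ := m.exists_uniform_continuous_geodesicFlow
  have hn : ∀ s : ℝ, Continuous (m.geodesicFlow s) → ∀ n : ℕ,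
      Continuous (m.geodesicFlow (n * s)) := by
    intro s hs n
    induction n with
    | zero => simpa [funext m.geodesicFlow_zero] using continuous_id'
    | succ n ih =>
      have e : m.geodesicFlow ((n + 1 : ℕ) * s) = m.geodesicFlow (n * s) ∘ m.geodesicFlow s :=
        funext fun v => by
          rw [Function.comp_apply, ← m.geodesicFlow_add]
          push_cast
          ring_nf
      rw [e]
      exact ih.comp hs
  have hnn : ∀ s : ℝ, 0 ≤ s → Continuous (m.geodesicFlow s) := by
    intro s hs
    obtain ⟨n, hn'⟩ := exists_nat_gt (s / ε)
    have hn0 : (0 : ℝ) < n := lt_of_le_of_lt (by positivity) hn'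
    have := hn (s / n) (h _ ⟨by positivity, by
      rw [div_le_iff₀ hn0]
      rw [div_lt_iff₀ hε] at hn'
      linarith⟩) n
    rwa [mul_div_cancel₀ s hn0.ne'] at this
  rcases le_total 0 s with hs | hs
  · exact hnn s hs
  · have e : m.geodesicFlow s = fun v => opp (m.geodesicFlow (-s) (opp v)) := funext fun v => by
      rw [m.geodesicFlow_opp, opp_opp, neg_neg]
    rw [e]
    exact m.continuous_opp.comp ((hnn (-s) (by linarith)).comp m.continuous_opp)

/-- The geodesic flow is continuous. -/
theorem continuous_geodesicFlow :
    Continuous fun q : ℝ × m.UnitTangentBundle => m.geodesicFlow q.1 q.2 := by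
  rw [continuous_iff_continuousAt]
  rintro ⟨s, v⟩
  -- The group law moves joint continuity at time `s` to time `0`.
  have e : (fun q : ℝ × m.UnitTangentBundle => m.geodesicFlow q.1 q.2) =
      (fun q : ℝ × m.UnitTangentBundle => m.geodesicFlow q.1 q.2) ∘
        fun q => (q.1 - s, m.geodesicFlow s q.2) := funext fun q => by
    rw [Function.comp_apply, ← m.geodesicFlow_add, sub_add_cancel]
  rw [e]
  have hc : Continuous fun q : ℝ × m.UnitTangentBundle => (q.1 - s, m.geodesicFlow s q.2) :=
    (continuous_fst.sub continuous_const).prodMk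
      ((m.continuous_geodesicFlow_apply s).comp continuous_snd)
  refine ContinuousAt.comp ?_ hc.continuousAt
  rw [sub_self]
  exact m.continuousAt_geodesicFlow_zero _

end Flow

end SurfaceLamination.SmoothMetric

/-! ### Unit normals and rotations in the circle fibres. -/

namespace SurfaceLamination.SmoothMetric

variable {X : Type*} [TopologicalSpace X] {L : SurfaceLamination X} (m : L.SmoothMetric)

/-- The coordinate vector `u` turned by a right angle. -/
def quarterTurn (u : Plane) : Plane := (-u 1) • stdVec 0 + u 0 • stdVec 1

/-- The component of `quarterTurn u` orthogonal to the unit vector `u`. -/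
def perpCoord (i : L.ι) (p : Plane × L.T i) (u : Plane) : Plane :=
  quarterTurn u + (-m.coeff i (quarterTurn u) u p) • u

/-- A unit vector orthogonal to the unit vector `u`, in the coordinates of the chart `i`. -/
def normalCoord (i : L.ι) (p : Plane × L.T i) (u : Plane) : Plane :=
  (√(m.coeff i (m.perpCoord i p u) (m.perpCoord i p u) p))⁻¹ • m.perpCoord i p u

lemma sq_add_sq_pos_of_coeff_self {i : L.ι} {p : Plane × L.T i} {u : Plane}
    (hu : m.coeff i u u p = 1) : 0 < u 0 ^ 2 + u 1 ^ 2 := by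
  by_contra h
  have h0 : u 0 = 0 := by nlinarith [sq_nonneg (u 0), sq_nonneg (u 1)]
  have h1 : u 1 = 0 := by nlinarith [sq_nonneg (u 0), sq_nonneg (u 1)]
  rw [m.coeff_expand, h0, h1] at hu
  simp at hu

lemma perpCoord_ne_zero {i : L.ι} {p : Plane × L.T i} {u : Plane} (hu : m.coeff i u u p = 1) :
    m.perpCoord i p u ≠ 0 := by
  intro h
  have hpos := m.sq_add_sq_pos_of_coeff_self hu
  have h0 := congrArg (fun v : Plane => v 0) h
  have h1 := congrArg (fun v : Plane => v 1) h
  rw [perpCoord] at h0 h1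
  generalize m.coeff i (quarterTurn u) u p = k at h0 h1
  simp [quarterTurn, stdVec] at h0 h1
  -- The unknown coefficient `k` cancels in this combination, leaving `u 0 ^ 2 + u 1 ^ 2 = 0`.
  exact hpos.ne' (by linear_combination u 0 * h1 - u 1 * h0)

lemma coeff_perpCoord {i : L.ι} {p : Plane × L.T i} {u : Plane} (hu : m.coeff i u u p = 1) :
    m.coeff i (m.perpCoord i p u) u p = 0 := by
  rw [perpCoord, coeff_add_left, coeff_smul_left, hu]
  ring

lemma coeff_perpCoord_self_pos {i : L.ι} {p : Plane × L.T i} (hp : p ∈ (L.chart i).target)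
    {u : Plane} (hu : m.coeff i u u p = 1) :
    0 < m.coeff i (m.perpCoord i p u) (m.perpCoord i p u) p :=
  m.coeff_self_pos hp (m.perpCoord_ne_zero hu)

lemma coeff_normalCoord {i : L.ι} {p : Plane × L.T i} {u : Plane} (hu : m.coeff i u u p = 1) :
    m.coeff i u (m.normalCoord i p u) p = 0 := by
  rw [m.coeff_comm, normalCoord, coeff_smul_left, m.coeff_perpCoord hu, mul_zero]

lemma coeff_normalCoord_self {i : L.ι} {p : Plane × L.T i} (hp : p ∈ (L.chart i).target)
    {u : Plane} (hu : m.coeff i u u p = 1) :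
    m.coeff i (m.normalCoord i p u) (m.normalCoord i p u) p = 1 := by
  have h := m.coeff_perpCoord_self_pos hp hu
  rw [normalCoord, coeff_smul_left, coeff_smul_right, ← mul_assoc, ← mul_inv,
    Real.mul_self_sqrt h.le, inv_mul_cancel₀ h.ne']

lemma eq_normalCoord_or_neg {i : L.ι} {p : Plane × L.T i} (hp : p ∈ (L.chart i).target)
    {u x : Plane} (hu : m.coeff i u u p = 1) (hxu : m.coeff i u x p = 0)
    (hx : m.coeff i x x p = 1) : x = m.normalCoord i p u ∨ x = -m.normalCoord i p u := by
  have hpos := m.sq_add_sq_pos_of_coeff_self hu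
  have hw := m.coeff_perpCoord_self_pos hp hu
  obtain ⟨a, b, hab⟩ : ∃ a b : ℝ, x = a • u + b • m.perpCoord i p u := by
    -- Expand `x` in the Euclidean orthogonal basis `u`, `quarterTurn u`, then replace `quarterTurn
    -- u` by `perpCoord` plus a multiple of `u`.
    refine ⟨(x 0 * u 0 + x 1 * u 1) / (u 0 ^ 2 + u 1 ^ 2) +
      (x 1 * u 0 - x 0 * u 1) / (u 0 ^ 2 + u 1 ^ 2) * m.coeff i (quarterTurn u) u p,
      (x 1 * u 0 - x 0 * u 1) / (u 0 ^ 2 + u 1 ^ 2), ?_⟩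
    ext k
    fin_cases k
    · simp [perpCoord, quarterTurn, stdVec]
      field_simp
      ring
    · simp [perpCoord, quarterTurn, stdVec]
      field_simp
      ring
  have ha : a = 0 := by
    rw [m.coeff_comm, hab, coeff_add_left, coeff_smul_left, coeff_smul_left,
      m.coeff_perpCoord hu, hu] at hxu
    linarith
  rw [ha, zero_smul, zero_add] at hab
  rw [hab, coeff_smul_left, coeff_smul_right] at hx
  set w := m.coeff i (m.perpCoord i p u) (m.perpCoord i p u) p with hwdef
  have hr : √w ≠ 0 := (Real.sqrt_pos.2 hw).ne'
  have hsq : (b * √w) ^ 2 = 1 := by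
    rw [mul_pow, Real.sq_sqrt hw.le]
    linarith
  rw [hab, normalCoord, ← hwdef]
  rcases mul_self_eq_one_iff.1 ((sq _).symm.trans hsq) with h | h
  · exact Or.inl (by rw [eq_inv_of_mul_eq_one_left h])
  · refine Or.inr ?_
    have hb : b = -(√w)⁻¹ := by
      field_simp
      linarith
    rw [hb, neg_smul]

lemma continuousAt_normalCoord {i : L.ι} {q : (Plane × L.T i) × Plane}
    (hp : q.1 ∈ (L.chart i).target) (hu : m.coeff i q.2 q.2 q.1 = 1) :
    ContinuousAt (fun q : (Plane × L.T i) × Plane => m.normalCoord i q.1 q.2) q := by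
  have hJ : Continuous fun q : (Plane × L.T i) × Plane => quarterTurn q.2 := by
    unfold quarterTurn
    fun_prop
  have hw : ContinuousAt (fun q : (Plane × L.T i) × Plane => m.perpCoord i q.1 q.2) q :=
    hJ.continuousAt.add ((m.continuousAt_coeff continuousAt_fst hJ.continuousAt continuousAt_snd
      hp).neg.smul continuousAt_snd)
  have hsqrt : ContinuousAt (fun q : (Plane × L.T i) × Plane =>
      √(m.coeff i (m.perpCoord i q.1 q.2) (m.perpCoord i q.1 q.2) q.1)) q :=
    (m.continuousAt_coeff continuousAt_fst hw hw hp).sqrt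
  exact (hsqrt.inv₀ (Real.sqrt_pos.2 (m.coeff_perpCoord_self_pos hp hu)).ne').smul hw

lemma nonempty_unitTangentBundle [Nonempty X] : Nonempty m.UnitTangentBundle := by
  obtain ⟨x⟩ := ‹Nonempty X›
  obtain ⟨i, hi⟩ := L.cover x
  have h := m.coeff_stdVec_pos ((L.chart i).map_source hi) 0
  set w := m.coeff i (stdVec 0) (stdVec 0) (L.chart i x) with hw
  refine ⟨m.ofCoord i (L.chart i x) ((√w)⁻¹ • stdVec 0) ?_⟩
  rw [coeff_smul_left, coeff_smul_right, ← hw, ← mul_assoc, ← mul_inv,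
    Real.mul_self_sqrt h.le, inv_mul_cancel₀ h.ne']

variable {m}

/-- `n` is one of the two unit vectors orthogonal to the unit tangent vector `y`. -/
def IsUnitNormal (y : m.UnitTangentBundle) (n : L.TangentPlane y.1.proj) : Prop :=
  m.inner y.1.proj y.1.2 n = 0 ∧ m.inner y.1.proj n n = 1

/-- A unit normal of `y`, computed in the chart `i`. -/
def unitNormal (i : L.ι) (y : m.UnitTangentBundle) : L.TangentPlane y.1.proj :=
  L.vectorOfCoord i y.1.proj (m.normalCoord i (L.chart i y.1.proj) (L.vectorCoord i y.1))

lemma vectorCoord_unitNormal {i : L.ι} {y : m.UnitTangentBundle}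
    (hy : y.1.proj ∈ (L.chart i).source) :
    L.vectorCoord i ⟨y.1.proj, unitNormal i y⟩ =
      m.normalCoord i (L.chart i y.1.proj) (L.vectorCoord i y.1) :=
  L.vectorCoord_vectorOfCoord hy _

lemma isUnitNormal_unitNormal {i : L.ι} {y : m.UnitTangentBundle}
    (hy : y.1.proj ∈ (L.chart i).source) : IsUnitNormal y (unitNormal i y) := by
  have hu := m.coeff_vectorCoord_self y hy
  have ht := (L.chart i).map_source hy
  constructor
  · rw [← m.coeff_vectorCoord hy, vectorCoord_unitNormal hy]
    exact m.coeff_normalCoord hu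
  · rw [← m.coeff_vectorCoord hy, vectorCoord_unitNormal hy]
    exact m.coeff_normalCoord_self ht hu

/-- The leaves have dimension two, so a unit normal is determined up to sign. The sign depends on
the chart, and constructions on `T¹L` must be symmetric in it. -/
lemma IsUnitNormal.eq_or_eq_neg {i : L.ι} {y : m.UnitTangentBundle}
    (hy : y.1.proj ∈ (L.chart i).source) {n : L.TangentPlane y.1.proj} (hn : IsUnitNormal y n) :
    n = unitNormal i y ∨ n = -unitNormal i y := by
  have hu := m.coeff_vectorCoord_self y hy
  have ht := (L.chart i).map_source hy
  obtain ⟨h1, h2⟩ := hn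
  rw [← m.coeff_vectorCoord hy] at h1 h2
  have e := L.vectorOfCoord_vectorCoord (i := i) (p := ⟨y.1.proj, n⟩) hy
  dsimp only at e
  rcases m.eq_normalCoord_or_neg ht hu h1 h2 with h | h
  · exact Or.inl (by rw [← e, h]; rfl)
  · refine Or.inr ?_
    rw [← e, h, ← neg_one_smul ℝ (m.normalCoord i _ _), L.vectorOfCoord_smul, neg_one_smul]
    rfl

lemma IsUnitNormal.inner_rotate {y : m.UnitTangentBundle} {n : L.TangentPlane y.1.proj}
    (hn : IsUnitNormal y n) (α : ℝ) :
    m.inner y.1.proj (Real.cos α • y.1.2 + Real.sin α • n)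
      (Real.cos α • y.1.2 + Real.sin α • n) = 1 := by
  rw [inner_smul_add_smul_self, hn.1, hn.2, y.2]
  linarith [Real.cos_sq_add_sin_sq α]

open Classical in
/-- The unit tangent vector `y` turned by the angle `α` towards its unit normal `n`. -/
def rotate (y : m.UnitTangentBundle) (n : L.TangentPlane y.1.proj) (α : ℝ) :
    m.UnitTangentBundle :=
  if hn : IsUnitNormal y n then
    ⟨⟨y.1.proj, Real.cos α • y.1.2 + Real.sin α • n⟩, hn.inner_rotate α⟩ else y

lemma IsUnitNormal.rotate_val {y : m.UnitTangentBundle} {n : L.TangentPlane y.1.proj}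
    (hn : IsUnitNormal y n) (α : ℝ) :
    (rotate y n α).1 = ⟨y.1.proj, Real.cos α • y.1.2 + Real.sin α • n⟩ :=
  congrArg Subtype.val (dif_pos hn)

lemma proj_rotate (y : m.UnitTangentBundle) (n : L.TangentPlane y.1.proj) (α : ℝ) :
    (rotate y n α).1.proj = y.1.proj := by
  by_cases hn : IsUnitNormal y n
  · rw [hn.rotate_val]
  · have h : rotate y n α = y := dif_neg hn
    rw [h]

lemma IsUnitNormal.rotate_zero {y : m.UnitTangentBundle} {n : L.TangentPlane y.1.proj}
    (hn : IsUnitNormal y n) : rotate y n 0 = y := by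
  refine Subtype.ext ?_
  rw [hn.rotate_val, Real.cos_zero, Real.sin_zero, one_smul, zero_smul, add_zero]

lemma IsUnitNormal.rotate_pi {y : m.UnitTangentBundle} {n : L.TangentPlane y.1.proj}
    (hn : IsUnitNormal y n) : rotate y n Real.pi = opp y := by
  refine Subtype.ext ?_
  rw [hn.rotate_val, Real.cos_pi, Real.sin_pi, neg_one_smul, zero_smul, add_zero]
  rfl

lemma IsUnitNormal.neg {y : m.UnitTangentBundle} {n : L.TangentPlane y.1.proj}
    (hn : IsUnitNormal y n) : IsUnitNormal y (-n) := by
  refine ⟨?_, (inner_neg_neg _ _).trans hn.2⟩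
  rw [m.symm, ← neg_one_smul ℝ n, inner_smul_left, m.symm, hn.1, mul_zero]

lemma IsUnitNormal.rotate_neg {y : m.UnitTangentBundle} {n : L.TangentPlane y.1.proj}
    (hn : IsUnitNormal y n) (α : ℝ) : rotate y (-n) α = rotate y n (-α) := by
  refine Subtype.ext ?_
  rw [hn.neg.rotate_val, hn.rotate_val, Real.cos_neg, Real.sin_neg, neg_smul, smul_neg]

lemma continuousAt_rotate {i : L.ι} {q : m.UnitTangentBundle × ℝ}
    (hy : q.1.1.proj ∈ (L.chart i).source) :
    ContinuousAt (fun q : m.UnitTangentBundle × ℝ => rotate q.1 (unitNormal i q.1) q.2) q := by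
  have hsrc : ∀ᶠ q' : m.UnitTangentBundle × ℝ in 𝓝 q, q'.1.1.proj ∈ (L.chart i).source :=
    (m.continuous_proj.comp continuous_fst).continuousAt.eventually
      ((L.chart i).open_source.mem_nhds hy)
  have hcoord : ∀ q' : m.UnitTangentBundle × ℝ, q'.1.1.proj ∈ (L.chart i).source →
      L.vectorCoord i (rotate q'.1 (unitNormal i q'.1) q'.2).1 =
        Real.cos q'.2 • L.vectorCoord i q'.1.1 + Real.sin q'.2 •
          m.normalCoord i (L.chart i q'.1.1.proj) (L.vectorCoord i q'.1.1) := by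
    intro q' hq'
    rw [(isUnitNormal_unitNormal hq').rotate_val, L.vectorCoord_add, L.vectorCoord_smul,
      L.vectorCoord_smul, vectorCoord_unitNormal hq']
  have hc1 : ContinuousAt (fun q : m.UnitTangentBundle × ℝ => L.chart i q.1.1.proj) q :=
    ContinuousAt.comp (f := Prod.fst) (g := fun y : m.UnitTangentBundle => L.chart i y.1.proj)
      (m.continuousAt_coord hy).1 continuousAt_fst
  have hc2 : ContinuousAt (fun q : m.UnitTangentBundle × ℝ => L.vectorCoord i q.1.1) q :=
    ContinuousAt.comp (f := Prod.fst) (g := fun y : m.UnitTangentBundle => L.vectorCoord i y.1)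
      (m.continuousAt_coord hy).2 continuousAt_fst
  refine (m.tendsto_iff_of_mem (i := i) (by rw [proj_rotate]; exact hy)).2 ⟨?_, ?_, ?_⟩
  · simpa only [proj_rotate] using hsrc
  · simp only [proj_rotate]
    exact hc1
  · rw [hcoord q hy]
    refine Tendsto.congr' (hsrc.mono fun q' hq' => (hcoord q' hq').symm) ?_
    have hc3 : ContinuousAt (fun q : m.UnitTangentBundle × ℝ =>
        m.normalCoord i (L.chart i q.1.1.proj) (L.vectorCoord i q.1.1)) q :=
      ContinuousAt.comp (f := fun q : m.UnitTangentBundle × ℝ =>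
          (L.chart i q.1.1.proj, L.vectorCoord i q.1.1))
        (g := fun q : (Plane × L.T i) × Plane => m.normalCoord i q.1 q.2)
        (m.continuousAt_normalCoord ((L.chart i).map_source hy) (m.coeff_vectorCoord_self q.1 hy))
        (hc1.prodMk hc2)
    exact ((Real.continuous_cos.comp continuous_snd).continuousAt.smul hc2).add
      ((Real.continuous_sin.comp continuous_snd).continuousAt.smul hc3)

/-! ### Lifting the variation of a circle-valued function along half turns. -/

section Lift

variable {t₀ : ℝ} [Fact (0 < t₀)]

/-- The representative in `(-t₀ / 2, t₀ / 2]` of an element of the circle `ℝ / t₀ ℤ`. -/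
def angleRep (a : AddCircle t₀) : ℝ := AddCircle.equivIoc t₀ (-(t₀ / 2)) a

lemma coe_angleRep (a : AddCircle t₀) : (angleRep a : AddCircle t₀) = a :=
  AddCircle.coe_equivIoc

/-- The representative jumps only at the class of half the period, whose norm is exactly `t₀ / 2`.
-/
lemma continuousAt_angleRep {a : AddCircle t₀} (ha : ‖a‖ < t₀ / 2) :
    ContinuousAt (angleRep : AddCircle t₀ → ℝ) a := by
  have hpos : 0 < t₀ := Fact.out
  refine continuous_subtype_val.continuousAt.comp (AddCircle.continuousAt_equivIoc t₀ _ ?_)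
  rintro rfl
  rw [AddCircle.coe_neg, norm_neg, AddCircle.norm_half_period_eq, abs_of_pos hpos] at ha
  exact ha.false

/-- The variation of `σ` along the rotation of `y` to its opposite through the unit normal `n`,
measured along a subdivision in `N` steps. -/
def halfTurnLift (σ : m.UnitTangentBundle → AddCircle t₀) (N : ℕ) (y : m.UnitTangentBundle)
    (n : L.TangentPlane y.1.proj) : ℝ :=
  ∑ k ∈ Finset.range N, angleRep (σ (rotate y n (((k + 1 : ℕ) : ℝ) * (Real.pi / N))) -
    σ (rotate y n ((k : ℝ) * (Real.pi / N))))

/-- Modulo `t₀` the sum telescopes, and a rotation by `π` about either normal ends at the opposite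
vector. -/
lemma coe_halfTurnLift (σ : m.UnitTangentBundle → AddCircle t₀) {N : ℕ} (hN : 0 < N)
    {y : m.UnitTangentBundle} {n : L.TangentPlane y.1.proj} (hn : IsUnitNormal y n) :
    (halfTurnLift σ N y n : AddCircle t₀) = σ (opp y) - σ y := by
  have h : (halfTurnLift σ N y n : AddCircle t₀) = ∑ k ∈ Finset.range N,
      (σ (rotate y n (((k + 1 : ℕ) : ℝ) * (Real.pi / N))) -
        σ (rotate y n ((k : ℝ) * (Real.pi / N)))) := by
    unfold halfTurnLift
    have hs := map_sum (QuotientAddGroup.mk' (AddSubgroup.zmultiples t₀))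
      (fun k : ℕ => angleRep (σ (rotate y n (((k + 1 : ℕ) : ℝ) * (Real.pi / N))) -
        σ (rotate y n ((k : ℝ) * (Real.pi / N))))) (Finset.range N)
    refine hs.trans (Finset.sum_congr rfl fun k _ => coe_angleRep _)
  have hN' : (N : ℝ) ≠ 0 := by positivity
  rw [h, Finset.sum_range_sub (fun k : ℕ => σ (rotate y n ((k : ℝ) * (Real.pi / N)))),
    mul_div_cancel₀ _ hN', hn.rotate_pi, Nat.cast_zero, zero_mul, hn.rotate_zero]

lemma eventually_norm_sub_rotate_lt {σ : m.UnitTangentBundle → AddCircle t₀} (hσ : Continuous σ)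
    (v : m.UnitTangentBundle) :
    ∃ δ > 0, ∀ᶠ y in 𝓝 v, ∀ n, IsUnitNormal y n → ∀ α ∈ Icc 0 Real.pi, ∀ d ∈ Ico 0 δ,
      ‖σ (rotate y n (α + d)) - σ (rotate y n α)‖ < t₀ / 2 := by
  have hpos : 0 < t₀ := Fact.out
  obtain ⟨i, hi⟩ := L.cover v.1.proj
  -- The angles range over `[-π, π]` because turning towards the other normal amounts to turning by
  -- negative angles.
  have hev : ∀ᶠ q in 𝓝 (v, (0 : ℝ)), ∀ α ∈ Icc (-Real.pi) Real.pi,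
      ‖σ (rotate q.1 (unitNormal i q.1) (α + q.2)) - σ (rotate q.1 (unitNormal i q.1) α)‖ <
        t₀ / 2 := by
    refine isCompact_Icc.eventually_forall_of_forall_eventually fun α _ => ?_
    have h1 : ContinuousAt (fun q : (m.UnitTangentBundle × ℝ) × ℝ =>
        σ (rotate q.1.1 (unitNormal i q.1.1) (q.2 + q.1.2))) ((v, 0), α) :=
      hσ.continuousAt.comp (ContinuousAt.comp (x := ((v, (0 : ℝ)), α))
        (f := fun q : (m.UnitTangentBundle × ℝ) × ℝ => (q.1.1, q.2 + q.1.2))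
        (g := fun q : m.UnitTangentBundle × ℝ => rotate q.1 (unitNormal i q.1) q.2)
        (continuousAt_rotate (q := (v, α + 0)) hi) (by fun_prop))
    have h2 : ContinuousAt (fun q : (m.UnitTangentBundle × ℝ) × ℝ =>
        σ (rotate q.1.1 (unitNormal i q.1.1) q.2)) ((v, 0), α) :=
      hσ.continuousAt.comp (ContinuousAt.comp (x := ((v, (0 : ℝ)), α))
        (f := fun q : (m.UnitTangentBundle × ℝ) × ℝ => (q.1.1, q.2))
        (g := fun q : m.UnitTangentBundle × ℝ => rotate q.1 (unitNormal i q.1) q.2)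
        (continuousAt_rotate (q := (v, α)) hi) (by fun_prop))
    exact (h1.sub h2).norm.eventually (gt_mem_nhds (by simpa using hpos))
  rw [nhds_prod_eq] at hev
  obtain ⟨P, hP, Q, hQ, hPQ⟩ := eventually_prod_iff.1 hev
  obtain ⟨δ, hδ, hball⟩ := Metric.eventually_nhds_iff.1 hQ
  refine ⟨δ, hδ, ?_⟩
  filter_upwards [hP, m.continuous_proj.continuousAt.eventually
    ((L.chart i).open_source.mem_nhds hi)] with y hy hyi n hn α hα d hd
  rcases hn.eq_or_eq_neg hyi with rfl | rfl
  · exact hPQ hy (hball (y := d) (by simpa [abs_of_nonneg hd.1] using hd.2)) α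
      ⟨by linarith [hα.1, Real.pi_pos], hα.2⟩
  · have hu := isUnitNormal_unitNormal hyi
    rw [hu.rotate_neg, hu.rotate_neg, neg_add]
    exact hPQ hy (hball (y := -d) (by simpa [abs_of_nonneg hd.1] using hd.2)) (-α)
      ⟨by linarith [hα.2], by linarith [hα.1, Real.pi_pos]⟩

/-- One subdivision fine enough for all vectors and both normals keeps each increment away from the
discontinuity of `angleRep`, so that the lift is continuous in the vector. -/
lemma exists_subdivision [T2Space X] [CompactSpace X] {σ : m.UnitTangentBundle → AddCircle t₀}
    (hσ : Continuous σ) :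
    ∃ N : ℕ, 0 < N ∧ ∀ (y : m.UnitTangentBundle) (n : L.TangentPlane y.1.proj),
      IsUnitNormal y n → ∀ k < N, ‖σ (rotate y n (((k + 1 : ℕ) : ℝ) * (Real.pi / N))) -
        σ (rotate y n ((k : ℝ) * (Real.pi / N)))‖ < t₀ / 2 := by
  obtain ⟨δ, hδ, h⟩ : ∃ δ > 0, ∀ y ∈ (univ : Set m.UnitTangentBundle), ∀ n, IsUnitNormal y n →
      ∀ α ∈ Icc 0 Real.pi, ∀ d ∈ Ico 0 δ,
        ‖σ (rotate y n (α + d)) - σ (rotate y n α)‖ < t₀ / 2 := by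
    refine isCompact_univ.induction_on (p := fun S : Set m.UnitTangentBundle => ∃ δ > 0,
      ∀ y ∈ S, ∀ n, IsUnitNormal y n → ∀ α ∈ Icc 0 Real.pi, ∀ d ∈ Ico 0 δ,
        ‖σ (rotate y n (α + d)) - σ (rotate y n α)‖ < t₀ / 2) ?_ ?_ ?_ ?_
    · exact ⟨1, one_pos, fun y hy => hy.elim⟩
    · rintro S S' hS ⟨δ, hδ, h⟩
      exact ⟨δ, hδ, fun y hy => h y (hS hy)⟩
    · rintro S S' ⟨δ, hδ, h⟩ ⟨δ', hδ', h'⟩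
      refine ⟨min δ δ', lt_min hδ hδ', fun y hy n hn α hα d hd => hy.elim (fun hy => ?_)
        fun hy => ?_⟩
      · exact h y hy n hn α hα d ⟨hd.1, hd.2.trans_le (min_le_left _ _)⟩
      · exact h' y hy n hn α hα d ⟨hd.1, hd.2.trans_le (min_le_right _ _)⟩
    · intro v _
      obtain ⟨δ, hδ, h⟩ := eventually_norm_sub_rotate_lt hσ v
      exact ⟨_, mem_nhdsWithin_of_mem_nhds h, δ, hδ, fun y hy => hy⟩
  obtain ⟨N, hN⟩ := exists_nat_gt (Real.pi / δ)
  have hN0 : (0 : ℝ) < N := lt_of_le_of_lt (by positivity) hN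
  refine ⟨N, by exact_mod_cast hN0, fun y n hn k hk => ?_⟩
  have hstep : Real.pi / N < δ := by
    rw [div_lt_iff₀ hN0]
    rw [div_lt_iff₀ hδ] at hN
    linarith
  have hkN : (k : ℝ) ≤ N := by exact_mod_cast hk.le
  have := h y trivial n hn ((k : ℝ) * (Real.pi / N)) ⟨by positivity, by
    calc (k : ℝ) * (Real.pi / N) ≤ N * (Real.pi / N) := by gcongr
      _ = Real.pi := by field_simp⟩ (Real.pi / N) ⟨by positivity, hstep⟩
  convert this using 5
  push_cast
  ring

/-- Twice the difference between a continuous circle-valued function on the unit tangent bundle and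
its composition with the antipodal map lifts to a continuous real function. -/
theorem exists_continuous_lift_opp [T2Space X] [CompactSpace X]
    {σ : m.UnitTangentBundle → AddCircle t₀} (hσ : Continuous σ) :
    ∃ h : m.UnitTangentBundle → ℝ, Continuous h ∧
      ∀ y, (h y : AddCircle t₀) = 2 • (σ (opp y) - σ y) := by
  obtain ⟨N, hN, hsmall⟩ := exists_subdivision hσ
  -- Adding the lifts along the two half turns removes the dependence on the sign of the normal,
  -- hence on the chart; this is the origin of the factor `2`.
  set H : L.ι → m.UnitTangentBundle → ℝ := fun i y =>
    halfTurnLift σ N y (unitNormal i y) + halfTurnLift σ N y (-unitNormal i y)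
  have hH : ∀ i j y, y.1.proj ∈ (L.chart i).source → y.1.proj ∈ (L.chart j).source →
      H i y = H j y := by
    intro i j y hi hj
    rcases (isUnitNormal_unitNormal hi).eq_or_eq_neg hj with h | h
    · simp only [H, h]
    · simp only [H, h]
      rw [neg_neg, add_comm]
  have hcont : ∀ i y, y.1.proj ∈ (L.chart i).source → ContinuousAt (H i) y := by
    intro i y hi
    have hu := isUnitNormal_unitNormal hi
    have hrot : ∀ α : ℝ, ContinuousAt (fun y => σ (rotate y (unitNormal i y) α)) y := fun α =>
      hσ.continuousAt.comp (ContinuousAt.comp (f := fun y : m.UnitTangentBundle => (y, α))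
        (continuousAt_rotate (q := (y, α)) hi) (by fun_prop))
    have hrot' : ∀ α : ℝ, ContinuousAt (fun y => σ (rotate y (-unitNormal i y) α)) y := fun α => by
      refine (hrot (-α)).congr ?_
      filter_upwards [m.continuous_proj.continuousAt.eventually
        ((L.chart i).open_source.mem_nhds hi)] with y' hy'
      rw [(isUnitNormal_unitNormal hy').rotate_neg]
    refine ContinuousAt.add ?_ ?_
    · refine tendsto_finsetSum _ fun k hk => ?_
      exact (continuousAt_angleRep (hsmall y _ hu k (Finset.mem_range.1 hk))).tendsto.comp
        ((hrot _).sub (hrot _))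
    · refine tendsto_finsetSum _ fun k hk => ?_
      exact (continuousAt_angleRep (hsmall y _ hu.neg k (Finset.mem_range.1 hk))).tendsto.comp
        ((hrot' _).sub (hrot' _))
  -- The choice of chart need not be continuous in `y`; `hH` makes it harmless.
  choose I hI using fun y : m.UnitTangentBundle => L.cover y.1.proj
  refine ⟨fun y => H (I y) y, ?_, fun y => ?_⟩
  · rw [continuous_iff_continuousAt]
    intro y
    refine (hcont (I y) y (hI y)).congr ?_
    filter_upwards [m.continuous_proj.continuousAt.eventually
      ((L.chart (I y)).open_source.mem_nhds (hI y))] with y' hy'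
    exact hH _ _ _ hy' (hI y')
  · have hu := isUnitNormal_unitNormal (hI y)
    rw [AddCircle.coe_add, coe_halfTurnLift σ hN hu, coe_halfTurnLift σ hN hu.neg, two_nsmul]

end Lift

end SurfaceLamination.SmoothMetric

/-! ### The phase of a synchronized section and the contradiction. -/

/-- A map to a compact space whose graph is closed is continuous. -/
lemma continuous_of_isClosed_graph {Y Z : Type*} [TopologicalSpace Y] [TopologicalSpace Z]
    [CompactSpace Z] {f : Y → Z} (h : IsClosed {q : Y × Z | f q.1 = q.2}) : Continuous f := by
  refine continuous_iff_isClosed.2 fun C hC => ?_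
  -- The preimage is a projection along the compact factor `Z`, and such projections are closed
  -- maps.
  have e : f ⁻¹' C = Prod.fst '' ({q : Y × Z | f q.1 = q.2} ∩ Prod.snd ⁻¹' C) := by
    ext y
    constructor
    · intro hy
      exact ⟨(y, f y), ⟨rfl, hy⟩, rfl⟩
    · rintro ⟨⟨y', z⟩, ⟨h1, h2⟩, rfl⟩
      change f y' = z at h1
      change z ∈ C at h2
      change f y' ∈ C
      rwa [h1]
  rw [e]
  exact isClosedMap_fst_of_compactSpace _ (h.inter (hC.preimage continuous_snd))

/-- A continuous flow with a synchronized global transverse section has a continuous phase in a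
circle, which the flow turns at unit speed. -/
lemma exists_continuous_phase {Y : Type*} [TopologicalSpace Y] {g : ℝ → Y → Y}
    (hg : Continuous fun q : ℝ × Y => g q.1 q.2) (hadd : ∀ t s v, g (t + s) v = g t (g s v))
    {K : Set Y} (hK : IsClosed K) {t₀ : ℝ} (ht₀ : 0 < t₀)
    (h : ∀ v, ∃ s : ℝ, {t : ℝ | g t v ∈ K} = range fun n : ℤ => s + n * t₀) :
    ∃ σ : Y → AddCircle t₀, Continuous σ ∧ ∀ t v, σ (g t v) = σ v - (t : AddCircle t₀) := by
  have : Fact (0 < t₀) := ⟨ht₀⟩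
  choose s hs using h
  have hmem : ∀ v t, g t v ∈ K ↔ (s v : AddCircle t₀) = t := by
    intro v t
    have h1 : g t v ∈ K ↔ t ∈ range fun n : ℤ => s v + n * t₀ := by rw [← hs v]; rfl
    rw [h1, eq_comm, ← sub_eq_zero, ← AddCircle.coe_sub, AddCircle.coe_eq_zero_iff]
    simp only [mem_range, zsmul_eq_mul]
    exact exists_congr fun n => ⟨fun h => by linarith, fun h => by linarith⟩
  refine ⟨fun v => s v, continuous_of_isClosed_graph ?_, fun t v => ?_⟩
  -- Closedness of the graph is tested upstairs on `Y × ℝ`, where the graph becomes the set of `(v,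
  -- t)` with `g t v ∈ K`. The quotient by `t₀ℤ` is open, so its product with the identity is still
  -- a quotient map.
  · have hq : IsOpenQuotientMap (Prod.map id (QuotientAddGroup.mk : ℝ → AddCircle t₀) :
        Y × ℝ → Y × AddCircle t₀) :=
      IsOpenQuotientMap.id.prodMap QuotientAddGroup.isOpenQuotientMap_mk
    rw [← hq.isQuotientMap.isClosed_preimage]
    have e : (Prod.map id (QuotientAddGroup.mk : ℝ → AddCircle t₀)) ⁻¹'
        {q : Y × AddCircle t₀ | (s q.1 : AddCircle t₀) = q.2} =
        (fun q : Y × ℝ => g q.2 q.1) ⁻¹' K := by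
      ext ⟨v, t⟩
      exact (hmem v t).symm
    rw [e]
    exact hK.preimage (hg.comp continuous_swap)
  · have h1 : g (s (g t v)) (g t v) ∈ K := (hmem _ _).2 rfl
    rw [← hadd, hmem, AddCircle.coe_add] at h1
    change (s (g t v) : AddCircle t₀) = s v - t
    rw [h1, add_sub_cancel_right]

end

theorem lemma3p7 {X : Type*} [TopologicalSpace X] [TopologicalSpace.MetrizableSpace X]
    [CompactSpace X] [Nonempty X] (L : SurfaceLamination X) (m : L.SmoothMetric) :
    ¬ ∃ K : Set m.UnitTangentBundle, IsSynchronizedGlobalTransverseSection m.geodesicFlow K := by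
  rintro ⟨K, hK, t₀, ht₀, hsync⟩
  have : Fact (0 < t₀) := ⟨ht₀⟩
  obtain ⟨σ, hσ, hflow⟩ := exists_continuous_phase m.continuous_geodesicFlow m.geodesicFlow_add hK
    ht₀ hsync
  obtain ⟨h, hh, hlift⟩ := SurfaceLamination.SmoothMetric.exists_continuous_lift_opp hσ
  obtain ⟨v⟩ := m.nonempty_unitTangentBundle
  -- In time `t` the phase of `g_t v` drops by `t` and that of its opposite rises by `t`; the
  -- doubled difference therefore changes by `4 t` modulo `t₀`.
  have hcoe : ∀ t : ℝ, ∃ n : ℤ, (n : ℝ) = (h (m.geodesicFlow t v) - h v - 4 * t) / t₀ := by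
    intro t
    have h1 : ((h (m.geodesicFlow t v) - h v - 4 * t : ℝ) : AddCircle t₀) = 0 := by
      have h4 : ((4 * t : ℝ) : AddCircle t₀) = 4 • (t : AddCircle t₀) := by
        rw [← AddCircle.coe_nsmul]
        simp
      have h5 : SurfaceLamination.SmoothMetric.opp (m.geodesicFlow t v) =
          m.geodesicFlow (-t) (SurfaceLamination.SmoothMetric.opp v) := by
        rw [m.geodesicFlow_opp, neg_neg]
      rw [AddCircle.coe_sub, AddCircle.coe_sub, hlift, hlift, h4, h5, hflow, hflow,
        AddCircle.coe_neg]
      abel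
    obtain ⟨n, hn⟩ := (AddCircle.coe_eq_zero_iff t₀).1 h1
    refine ⟨n, ?_⟩
    rw [← hn, zsmul_eq_mul]
    field_simp
  choose n hn using hcoe
  have hcont : Continuous fun t => h (m.geodesicFlow t v) :=
    hh.comp (m.continuous_geodesicFlow.comp (Continuous.prodMk_left v))
  have hncont : Continuous n := by
    rw [Int.isClosedEmbedding_coe_real.isInducing.continuous_iff]
    have e : ((↑) : ℤ → ℝ) ∘ n = fun t => (h (m.geodesicFlow t v) - h v - 4 * t) / t₀ := funext hn
    rw [e]
    exact ((hcont.sub continuous_const).sub (continuous_const.mul continuous_id)).div_const t₀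
  have hconst : ∀ t, h (m.geodesicFlow t v) = h v + 4 * t := by
    intro t
    -- An integer-valued continuous function on the line is constant.
    have h0 : n t = n 0 := PreconnectedSpace.constant inferInstance hncont
    have h1 := hn t
    rw [h0, hn 0, m.geodesicFlow_zero] at h1
    field_simp at h1
    linarith
  obtain ⟨C, hC⟩ := isCompact_univ.exists_bound_of_continuousOn hh.continuousOn
  -- By time `C + 1` the function has grown by `4 (C + 1)`, more than the `2 C` that the bound `|h|
  -- ≤ C` allows.
  have h1 := hC (m.geodesicFlow (C + 1) v) trivial
  have h2 := hC v trivial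
  rw [hconst, Real.norm_eq_abs, abs_le] at h1
  rw [Real.norm_eq_abs, abs_le] at h2
  linarith
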